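/- **Model.** Fix constants $d\ge 1$, $\alpha>1$, $2<\beta<3$. Let $\mathbb T^d=\mathbb R^d/\mathbb Z^d$ carry the uniform probability measure $\mathrm{vol}$. A *distance function* is a measurable map $\|\cdot\|:\mathbb T^d\to\mathbb R_{\ge 0}$ (not necessarily a norm or metric) with $\|x\|=\|-x\|$ and $\|0\|=0$ such that $V(r):=\mathrm{vol}\{x\in\mathbb T^d:\|x\|\le r\}$, $r\ge0$, attains every value in $[0,1]$; the distance of $x$ and $y$ is $\|x-y\|$. For every $n$ let positive weights $w_1,\dots,w_n$ (depending on $n$) be given, with $w_{\min}:=\min_v w_v=\Omega(1)$, and such that for some $\bar w=\bar w(n)\ge n^{\omega(1/\log\log n)}$ the following holds: for every constant $\eta>0$ there are $c_1,c_2>0$ such that for all sufficiently large $n$, $$c_1\frac{n}{w^{\beta-1+\eta}}\le \#\{v: w_v\ge w\}\le c_2\frac{n}{w^{\beta-1-\eta}},$$ the second inequality for all $w\ge w_{\min}$ and the first for all $w_{\min}\le w\le\bar w$. For every $n$ let $p=p(x_u,x_v,w_u,w_v)\in[0,1]$ be a function, measurable in the positions, such that for some constants $c_L,c_U>0$ and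 all sufficiently large $n$, $$c_L\min\Big\{1,\Big(\tfrac{w_uw_v}{n\,V(\|x_u-x_v\|)}\Big)^{\alpha}\Big\}\le p(x_u,x_v,w_u,w_v)\le c_U\min\Big\{1,\Big(\tfrac{w_uw_v}{n\,V(\|x_u-x_v\|)}\Big)^{\alpha}\Big\}$$ for all $x_u\ne x_v$ in $\mathbb T^d$ and all $w_u,w_v>0$ (the minimum is $1$ if $V(\|x_u-x_v\|)=0$). A *GIRG* $G=G_n$ is the random graph on $\{1,\dots,n\}$ obtained by drawing independent uniform positions $x_v\in\mathbb T^d$ and then inserting each edge $\{u,v\}$, $u<v$, independently with probability $p(x_u,x_v,w_u,w_v)$. The distance function satisfies the *stochastic triangle inequality* if there is a constant $C>0$ such that, for $x_1,x_2$ independent and uniform in the $\varepsilon$-ball $\{x:\|x\|\le\varepsilon\}$, $$\liminf_{\varepsilon\to0}\Pr[\|x_1-x_2\|\le C\varepsilon]>0\qquad\text{and}\qquad \liminf_{\varepsilon\to0}\frac{V(\varepsilon)}{V(C\varepsilon)}>0,$$ where in particular the balls have positive volume, so that the uniform distribution is defined. The clustering coefficient of a vertex $v$ is $\mathrm{cc}(v)=\binom{\deg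 v}{2}^{-1}\cdot\#\{\text{triangles containing }v\}$ if $\deg v\ge2$ and $0$ otherwise, and $\mathrm{cc}(G)=\frac1n\sum_v\mathrm{cc}(v)$. **Theorem.** If the distance function satisfies the stochastic triangle inequality, then $\mathrm{cc}(G)=\Omega(1)$ with high probability, i.e. there is a constant $c>0$ with $\Pr[\mathrm{cc}(G_n)\ge c]\to1$ as $n\to\infty$. In particular, the minimum component distance $\|x\|_{\min}=\min_{1\le i\le d}|x_i|_T$, where $|a|_T$ is the distance of $a$ to $0$ on the circle $\mathbb R/\mathbb Z$, is a distance function that satisfies the stochastic triangle inequality, and the conclusion holds for GIRGs with this distance function, whether the edge probabilities are formulated with its volume function $V$ or with $V(r):=r$. -/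

import Mathlib

open MeasureTheory Filter Topology Set

namespace GIRG

/-- The `d`-dimensional torus `ℝ^d / ℤ^d`. Its `volume` is the uniform probability measure. -/
abbrev Torus (d : ℕ) : Type := Fin d → UnitAddCircle

/-- The `r`-ball around the origin for a distance function `dist`. -/
def ball {d : ℕ} (dist : Torus d → ℝ) (r : ℝ) : Set (Torus d) := {x | dist x ≤ r}

/-- The volume function `V(r) = vol {x | dist x ≤ r}`. -/
noncomputable def ballVol {d : ℕ} (dist : Torus d → ℝ) (r : ℝ) : ℝ :=
  (volume (ball dist r)).toReal

/-- A translation invariant, symmetric (not necessarily metric) distance function on the torus: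
the distance of `x` and `y` is `dist (x - y)`. -/
structure IsDistanceFunction {d : ℕ} (dist : Torus d → ℝ) : Prop where
  measurable : Measurable dist
  nonneg : ∀ x, 0 ≤ dist x
  symm : ∀ x, dist (-x) = dist x
  zero : dist 0 = 0
  surj : SurjOn (ballVol dist) (Ici 0) (Icc 0 1)

/-- The stochastic triangle inequality. Two independent uniform points of the `ε`-ball are
distributed according to the product of two copies of `volume` conditioned on the ball; if the
ball has measure zero for arbitrarily small `ε > 0`, both lower limits are `0` and the
property fails. -/
def StochasticTriangleInequality {d : ℕ} (dist : Torus d → ℝ) : Prop :=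
  ∃ C : ℝ, 0 < C ∧
    0 < liminf (fun ε : ℝ =>
      ((ProbabilityTheory.cond volume (ball dist ε)).prod
        (ProbabilityTheory.cond volume (ball dist ε)))
          {z : Torus d × Torus d | dist (z.1 - z.2) ≤ C * ε}) (𝓝[>] 0) ∧
    0 < liminf (fun ε : ℝ => volume (ball dist ε) / volume (ball dist (C * ε))) (𝓝[>] 0)

/-- The minimum component distance `min_i |x_i|_T`. The norm of `UnitAddCircle` is the distance
to `0` on the circle, so `‖a - b‖ = min (|a - b|) (1 - |a - b|)` for `a, b ∈ [0, 1]`. -/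
noncomputable def mcd (d : ℕ) (x : Torus d) : ℝ := ⨅ i, ‖x i‖

/-- `min {1, (a / (n V))^α}`, which is `1` when `V = 0` (then the quotient is infinite). -/
noncomputable def kernel (α : ℝ) (n : ℕ) (a V : ℝ) : ℝ :=
  if V = 0 then 1 else min 1 ((a / (n * V)) ^ α)

/-- The requirements on the edge probabilities `p = p n x_u x_v w_u w_v`, for a distance function
`dist` and a volume function `V`. -/
structure IsEdgeProbability {d : ℕ} (α : ℝ) (dist : Torus d → ℝ) (V : ℝ → ℝ)
    (p : ℕ → Torus d → Torus d → ℝ → ℝ → ℝ) : Prop where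
  mem_Icc : ∀ n x y, ∀ a > 0, ∀ b > 0, p n x y a b ∈ Icc (0 : ℝ) 1
  measurable : ∀ n, ∀ a > 0, ∀ b > 0,
    Measurable (fun z : Torus d × Torus d => p n z.1 z.2 a b)
  theta : ∃ cL > 0, ∃ cU > 0, ∀ᶠ n : ℕ in atTop, ∀ x y : Torus d, x ≠ y → ∀ a > 0, ∀ b > 0,
    cL * kernel α n (a * b) (V (dist (x - y))) ≤ p n x y a b ∧
    p n x y a b ≤ cU * kernel α n (a * b) (V (dist (x - y)))

/-- The number of vertices of weight at least `t`. -/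
noncomputable def numGE {n : ℕ} (w : Fin n → ℝ) (t : ℝ) : ℕ := {v : Fin n | t ≤ w v}.ncard

/-- The weak power law condition with exponent `β`; for `n ≥ 1`, `⨅ v, w n v` is the minimum
weight. The lower bound holds up to a threshold `wbar n ≥ n ^ f n`, where
`f n = ω(1 / log log n)`. -/
structure IsPowerLawWeights (β : ℝ) (w : ∀ n : ℕ, Fin n → ℝ) : Prop where
  pos : ∀ n v, 0 < w n v
  min_weight : ∃ c > 0, ∀ᶠ n : ℕ in atTop, c ≤ (⨅ v, w n v)
  power_law : ∃ wbar : ℕ → ℝ,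
    (∃ f : ℕ → ℝ, Tendsto (fun n : ℕ => f n * Real.log (Real.log n)) atTop atTop ∧
      ∀ᶠ n : ℕ in atTop, (n : ℝ) ^ f n ≤ wbar n) ∧
    ∀ η > 0, ∃ c₁ > 0, ∃ c₂ > 0, ∀ᶠ n : ℕ in atTop,
      (∀ t : ℝ, (⨅ v, w n v) ≤ t → t ≤ wbar n → c₁ * (n / t ^ (β - 1 + η)) ≤ numGE (w n) t) ∧
      (∀ t : ℝ, (⨅ v, w n v) ≤ t → numGE (w n) t ≤ c₂ * (n / t ^ (β - 1 - η)))

/-- The sample space of the random graph: independent uniform positions of the vertices and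
independent uniform variables in `[0, 1]` which realise the coin flips for pairs of vertices.
Its `volume` is the product probability measure. -/
abbrev Sample (d n : ℕ) : Type := (Fin n → Torus d) × (Fin n → Fin n → unitInterval)

/-- The random graph: given the positions, each pair `u < v` is an edge independently with
probability `p x_u x_v w_u w_v`. -/
def girg {d n : ℕ} (w : Fin n → ℝ) (p : Torus d → Torus d → ℝ → ℝ → ℝ) (ω : Sample d n) :
    SimpleGraph (Fin n) :=
  SimpleGraph.fromRel (fun u v => u < v ∧ (ω.2 u v : ℝ) < p (ω.1 u) (ω.1 v) (w u) (w v))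

/-- The clustering coefficient of a vertex. -/
noncomputable def ccVertex {V : Type*} (G : SimpleGraph V) (v : V) : ℝ :=
  if 2 ≤ (G.neighborSet v).ncard then
    ({s : Finset V | G.IsNClique 3 s ∧ v ∈ s}.ncard : ℝ) / ((G.neighborSet v).ncard.choose 2 : ℝ)
  else 0

/-- The (mean) clustering coefficient of a finite graph. -/
noncomputable def cc {V : Type*} [Fintype V] (G : SimpleGraph V) : ℝ :=
  (1 / (Fintype.card V : ℝ)) * ∑ v, ccVertex G v

/-- With high probability, the clustering coefficient of the random graph is `Ω(1)`. -/
def ClusteringWhp {d : ℕ} (w : ∀ n : ℕ, Fin n → ℝ)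
    (p : ℕ → Torus d → Torus d → ℝ → ℝ → ℝ) : Prop :=
  ∃ c : ℝ, 0 < c ∧
    Tendsto (fun n : ℕ => volume {ω : Sample d n | c ≤ cc (girg (w n) (p n) ω)}) atTop (𝓝 1)

end GIRG

/-! The mean of the clustering coefficient is bounded below by local geometry, and a variance bound
then gives concentration.

For the mean, choose `ε` with `V(ε) = δ / n`. By the stochastic triangle inequality, two other
vertices lie `ε`-close to `v` and `Cε`-close to each other with probability at least a constant
times `(δ / n) ^ 2`. The balls of radius `ε` and `C * ε` have volume `O(1 / n)`. With `δ` small, the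
kernel equals `1` on all three pairs, and they form a triangle with constant probability. There are
about `n ^ 2` candidate pairs. Requiring that no further vertex is close to `v` makes the
corresponding events disjoint, so their probabilities add up to a constant
(`le_measureReal_inTriangle`, `exists_le_measureReal_inTriangle`). A triangle helps only if `deg v`
is bounded. The kernel integrates to `O(w_u w_v / n)` because `α > 1` (`lintegral_kernel_le`), and
the total weight is `O(n)` because `β > 2`, so the expected degree is `O(w_v)`. On average over `v`
a large cutoff `K` on the degree costs little (`le_integral_sum_ccVertex`).

For concentration, apply Efron–Stein (`variance_le_sum_resample`) to the independent data of the
vertices, each consisting of a position and a row of coins. Resampling vertex `k` changes the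
coefficients only of `k` and of its old and new neighbours. Hence the variance of the sum is `O(∑ (1
+ E[deg ^ 2])) = O(n + ∑ w_v ^ 2)`. This is `o(n ^ 2)`, since the power law bounds the largest
weight by a power of `n` with exponent below `1`. Chebyshev's inequality finishes the argument.

For the minimum component distance, two points of a small ball are small in the same component with
probability at least `1 / d ^ 2`, and the triangle inequality on the circle applies there. -/

namespace GIRG

/-! ### The Efron–Stein inequality via exchangeable copies. -/

section EfronStein

variable {ι Ξ : Type*} [Fintype ι] [DecidableEq ι] [MeasurableSpace Ξ]

/-- Replace the coordinates in `s` by those of the second copy. -/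
def mix (s : Finset ι) (z : ι → Ξ × Ξ) : ι → Ξ := fun i => if i ∈ s then (z i).2 else (z i).1

/-- Exchange the two copies in the coordinates in `s`. -/
def swapOn (s : Finset ι) (z : ι → Ξ × Ξ) : ι → Ξ × Ξ := fun i => if i ∈ s then (z i).swap else z i

omit [Fintype ι] [MeasurableSpace Ξ] in
lemma mix_swapOn (s t : Finset ι) (z : ι → Ξ × Ξ) :
    mix s (swapOn t z) = mix (symmDiff s t) z := by
  funext i
  by_cases hs : i ∈ s <;> by_cases ht : i ∈ t <;>
    simp [mix, swapOn, Finset.mem_symmDiff, hs, ht]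

omit [Fintype ι] in
lemma measurable_mix (s : Finset ι) : Measurable (mix (Ξ := Ξ) s) := by
  refine measurable_pi_lambda _ fun i => ?_
  by_cases h : i ∈ s
  · simpa [mix, h] using (measurable_pi_apply i).snd
  · simpa [mix, h] using (measurable_pi_apply i).fst

variable (μ : Measure Ξ) [IsProbabilityMeasure μ]

lemma measurePreserving_swapOn (s : Finset ι) :
    MeasurePreserving (swapOn (Ξ := Ξ) s) (Measure.pi fun _ : ι => μ.prod μ)
      (Measure.pi fun _ : ι => μ.prod μ) := by
  have h : ∀ i : ι, MeasurePreserving (fun y : Ξ × Ξ => if i ∈ s then y.swap else y)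
      (μ.prod μ) (μ.prod μ) := by
    intro i
    by_cases hi : i ∈ s
    · simpa [hi] using (Measure.measurePreserving_swap (μ := μ) (ν := μ))
    · simp only [hi, if_false]
      exact MeasurePreserving.id (μ.prod μ)
  exact measurePreserving_pi _ _ h

lemma integrable_of_abs_le {Ω : Type*} [MeasurableSpace Ω] {P : Measure Ω} [IsFiniteMeasure P]
    {f : Ω → ℝ} (hf : Measurable f) {B : ℝ} (hB : ∀ x, |f x| ≤ B) : Integrable f P :=
  Integrable.of_bound hf.aestronglyMeasurable B (Eventually.of_forall hB)

variable {f : (ι → Ξ) → ℝ}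

/-- The two copies are exchangeable in each coordinate separately, so both index sets may be shifted
by a common symmetric difference. -/
lemma integral_mix_mul_mix (s t r : Finset ι) (hf : Measurable f) :
    ∫ z, f (mix s z) * f (mix t z) ∂(Measure.pi fun _ : ι => μ.prod μ) =
      ∫ z, f (mix (symmDiff s r) z) * f (mix (symmDiff t r) z)
        ∂(Measure.pi fun _ : ι => μ.prod μ) := by
  have h := measurePreserving_swapOn (ι := ι) μ r
  have hm : Measurable fun z : ι → Ξ × Ξ => f (mix s z) * f (mix t z) :=
    (hf.comp (measurable_mix s)).mul (hf.comp (measurable_mix t))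
  conv_lhs => rw [← h.map_eq]
  rw [integral_map h.measurable.aemeasurable hm.aestronglyMeasurable]
  simp only [mix_swapOn]

/-- Resample the coordinates of `s` one at a time: the left side telescopes, and each increment is
at most half the effect of resampling that coordinate alone. -/
lemma integral_mix_sub_le (hf : Measurable f) {B : ℝ} (hB : ∀ x, |f x| ≤ B) (s : Finset ι) :
    ∫ z, f (mix ∅ z) * f (mix ∅ z) ∂(Measure.pi fun _ : ι => μ.prod μ) -
      ∫ z, f (mix ∅ z) * f (mix s z) ∂(Measure.pi fun _ : ι => μ.prod μ) ≤
    1 / 2 * ∑ k ∈ s, ∫ z, (f (mix ∅ z) - f (mix {k} z)) ^ 2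
      ∂(Measure.pi fun _ : ι => μ.prod μ) := by
  have int : ∀ s t : Finset ι, Integrable (fun z : ι → Ξ × Ξ => f (mix s z) * f (mix t z))
      (Measure.pi fun _ : ι => μ.prod μ) := fun s t =>
    integrable_of_abs_le (B := B * B)
      ((hf.comp (measurable_mix s)).mul (hf.comp (measurable_mix t))) fun x => by
        rw [abs_mul]
        exact mul_le_mul (hB _) (hB _) (abs_nonneg _) ((abs_nonneg _).trans (hB (mix s x)))
  set I : Finset ι → Finset ι → ℝ := fun s t =>
    ∫ z, f (mix s z) * f (mix t z) ∂(Measure.pi fun _ : ι => μ.prod μ) with hI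
  have hsh : ∀ s t r : Finset ι, I s t = I (symmDiff s r) (symmDiff t r) := fun s t r =>
    integral_mix_mul_mix μ s t r hf
  have hsq : ∀ s t, ∫ z, (f (mix s z) - f (mix t z)) ^ 2 ∂(Measure.pi fun _ : ι => μ.prod μ) =
      I s s - 2 * I s t + I t t := by
    intro s t
    have e1 := integral_add ((int s s).sub ((int s t).const_mul 2)) (int t t)
    have e2 := integral_sub (int s s) ((int s t).const_mul 2)
    simp only [Pi.sub_apply] at e1
    rw [e2, integral_const_mul] at e1
    rw [hI]
    simp only
    rw [← e1]
    congr 1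
    funext z
    ring
  change I ∅ ∅ - I ∅ s ≤ _
  induction s using Finset.induction_on with
  | empty => simp
  | insert k s hk ih =>
    rw [Finset.sum_insert hk, mul_add]
    have key : I ∅ s - I ∅ (insert k s) ≤
        1 / 2 * ∫ z, (f (mix ∅ z) - f (mix {k} z)) ^ 2 ∂(Measure.pi fun _ : ι => μ.prod μ) := by
      have e1 : symmDiff s {k} = insert k s := by
        ext i; by_cases h : i = k <;> simp [Finset.mem_symmDiff, h, hk]
      have e2 : symmDiff (insert k s) {k} = s := by
        rw [← e1, symmDiff_symmDiff_cancel_right]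
      have e0 : symmDiff (∅ : Finset ι) {k} = {k} := by
        ext; simp [Finset.mem_symmDiff]
      have e3 : symmDiff {k} s = insert k s := by rw [symmDiff_comm, e1]
      have e4 : symmDiff (∅ : Finset ι) s = s := by
        ext; simp [Finset.mem_symmDiff]
      have a1 : I ∅ s = I {k} (insert k s) := by rw [hsh _ _ {k}, e0, e1]
      have a2 : I ∅ (insert k s) = I {k} s := by rw [hsh _ _ {k}, e0, e2]
      -- The mixed second difference in `k` and `s` has nonnegative mean square. Expanding it and
      -- using exchangeability gives `2 * J - 4 * (I ∅ s - I ∅ (insert k s)) ≥ 0`, where `J` is the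
      -- mean square effect of resampling `k`.
      have hd : 0 ≤ ∫ z, ((f (mix ∅ z) - f (mix {k} z)) - (f (mix s z) - f (mix (insert k s) z))) ^ 2
          ∂(Measure.pi fun _ : ι => μ.prod μ) := integral_nonneg fun _ => sq_nonneg _
      have hexp : ∫ z, ((f (mix ∅ z) - f (mix {k} z)) -
          (f (mix s z) - f (mix (insert k s) z))) ^ 2 ∂(Measure.pi fun _ : ι => μ.prod μ) =
          (∫ z, (f (mix ∅ z) - f (mix {k} z)) ^ 2 ∂(Measure.pi fun _ : ι => μ.prod μ)) +
          (∫ z, (f (mix s z) - f (mix (insert k s) z)) ^ 2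
            ∂(Measure.pi fun _ : ι => μ.prod μ)) - 2 * (I ∅ s - I ∅ (insert k s) - I {k} s
            + I {k} (insert k s)) := by
        have i1 : ∀ s t, Integrable (fun z : ι → Ξ × Ξ => (f (mix s z) - f (mix t z)) ^ 2)
            (Measure.pi fun _ : ι => μ.prod μ) := fun s t => by
          have := ((int s s).sub ((int s t).const_mul 2)).add (int t t)
          refine this.congr (Eventually.of_forall fun z => ?_)
          simp only [Pi.add_apply, Pi.sub_apply]
          ring
        have j1 := (int ∅ s).sub (int ∅ (insert k s))
        have j2 := j1.sub (int {k} s)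
        have j3 := j2.add (int {k} (insert k s))
        have t1 := integral_sub (int ∅ s) (int ∅ (insert k s))
        have t2 := integral_sub j1 (int {k} s)
        have t3 := integral_add j2 (int {k} (insert k s))
        have t4 := integral_add (i1 ∅ {k}) (i1 s (insert k s))
        have t5 := integral_sub ((i1 ∅ {k}).add (i1 s (insert k s))) (j3.const_mul 2)
        simp only [Pi.sub_apply, Pi.add_apply] at t1 t2 t3 t4 t5
        rw [integral_const_mul, t4, t3, t2, t1] at t5
        rw [hI]
        simp only
        rw [← t5]
        congr 1
        funext z
        ring
      have b1 : I s s = I ∅ ∅ := by rw [hsh s s s, symmDiff_self]; rfl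
      have b2 : I (insert k s) (insert k s) = I {k} {k} := by
        rw [hsh {k} {k} s, e3]
      have b3 : I s (insert k s) = I ∅ {k} := by rw [hsh ∅ {k} s, e3, e4]
      have hs2 : ∫ z, (f (mix s z) - f (mix (insert k s) z)) ^ 2
            ∂(Measure.pi fun _ : ι => μ.prod μ) =
          ∫ z, (f (mix ∅ z) - f (mix {k} z)) ^ 2 ∂(Measure.pi fun _ : ι => μ.prod μ) := by
        rw [hsq, hsq, b1, b2, b3]
      rw [hexp, hs2, ← a1, ← a2] at hd
      linarith
    linarith

/-- The Efron–Stein inequality for bounded functions. -/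
theorem variance_le_sum_resample (hf : Measurable f) {B : ℝ} (hB : ∀ x, |f x| ≤ B) :
    ProbabilityTheory.variance f (Measure.pi fun _ : ι => μ) ≤
      1 / 2 * ∑ k, ∫ z, (f (mix ∅ z) - f (mix {k} z)) ^ 2
        ∂(Measure.pi fun _ : ι => μ.prod μ) := by
  have h := integral_mix_sub_le μ hf hB Finset.univ
  have hm := measurePreserving_arrowProdEquivProdArrow Ξ Ξ ι (fun _ => μ) (fun _ => μ)
  -- Resampling nothing and resampling everything yield the two independent copies, so the left side
  -- of `h` becomes the variance.
  have m0 : ∀ z : ι → Ξ × Ξ, mix ∅ z = (MeasurableEquiv.arrowProdEquivProdArrow Ξ Ξ ι z).1 := by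
    intro z; funext i; simp [mix, MeasurableEquiv.arrowProdEquivProdArrow,
      Equiv.arrowProdEquivProdArrow]
  have m1 : ∀ z : ι → Ξ × Ξ, mix Finset.univ z =
      (MeasurableEquiv.arrowProdEquivProdArrow Ξ Ξ ι z).2 := by
    intro z; funext i; simp [mix, MeasurableEquiv.arrowProdEquivProdArrow,
      Equiv.arrowProdEquivProdArrow]
  have i1 : ∫ z, f (mix ∅ z) * f (mix ∅ z) ∂(Measure.pi fun _ : ι => μ.prod μ) =
      ∫ x, f x ^ 2 ∂(Measure.pi fun _ : ι => μ) := by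
    simp only [m0]
    rw [hm.integral_comp (MeasurableEquiv.measurableEmbedding _) (fun y => f y.1 * f y.1)]
    have := integral_prod_mul (μ := Measure.pi fun _ : ι => μ) (ν := Measure.pi fun _ : ι => μ)
      (fun x => f x * f x) (fun _ => (1 : ℝ))
    simpa [sq] using this
  have i2 : ∫ z, f (mix ∅ z) * f (mix Finset.univ z) ∂(Measure.pi fun _ : ι => μ.prod μ) =
      (∫ x, f x ∂(Measure.pi fun _ : ι => μ)) ^ 2 := by
    simp only [m0, m1]
    rw [hm.integral_comp (MeasurableEquiv.measurableEmbedding _) (fun y => f y.1 * f y.2),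
      integral_prod_mul f f, sq]
  have hL : MemLp f 2 (Measure.pi fun _ : ι => μ) :=
    MemLp.of_bound hf.aestronglyMeasurable B (Eventually.of_forall hB)
  rw [ProbabilityTheory.variance_eq_sub hL]
  rw [i1, i2] at h
  simpa using h

end EfronStein

/-! ### Relative positions on the torus are independent and uniform. -/

section Haar

variable {G : Type*} [AddCommGroup G] [TopologicalSpace G] [IsTopologicalAddGroup G]
  [CompactSpace G] [SecondCountableTopology G] [MeasureSpace G] [BorelSpace G]
  [Measure.IsAddHaarMeasure (volume : Measure G)] [IsProbabilityMeasure (volume : Measure G)]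
  {ι : Type*} [Fintype ι] [DecidableEq ι]

/-- A continuous surjective homomorphism of compact groups carries normalised Haar measure to
normalised Haar measure. The next two lemmas use the same argument for two and three differences. -/
lemma measurePreserving_sub_apply {k u : ι} (h : u ≠ k) :
    MeasurePreserving (fun x : ι → G => x u - x k) volume volume := by
  let φ : (ι → G) →+ G :=
    { toFun := fun x => x u - x k, map_zero' := by simp,
      map_add' := fun x y => by simp; abel }
  refine AddMonoidHom.measurePreserving (f := φ) ?_ ?_ (by simp)
  · change Continuous fun x : ι → G => x u - x k
    fun_prop
  · intro y
    refine ⟨fun i => if i = u then y else 0, ?_⟩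
    simp [φ, h.symm]

lemma measurePreserving_sub_apply₂ {k u v : ι} (hu : u ≠ k) (hv : v ≠ k) (huv : u ≠ v) :
    MeasurePreserving (fun x : ι → G => (x u - x k, x v - x k)) volume volume := by
  let φ : (ι → G) →+ G × G :=
    { toFun := fun x => (x u - x k, x v - x k), map_zero' := by simp,
      map_add' := fun x y => by ext <;> simp <;> abel }
  have : Measure.IsAddHaarMeasure (volume : Measure (G × G)) :=
    inferInstanceAs (Measure.IsAddHaarMeasure ((volume : Measure G).prod volume))
  refine AddMonoidHom.measurePreserving (f := φ) ?_ ?_ (by simp)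
  · change Continuous fun x : ι → G => (x u - x k, x v - x k)
    fun_prop
  · rintro ⟨a, b⟩
    refine ⟨fun i => if i = u then a else if i = v then b else 0, ?_⟩
    simp [φ, hu.symm, hv.symm, huv.symm]

lemma measurePreserving_sub_apply₃ {k u v z : ι} (hu : u ≠ k) (hv : v ≠ k) (hz : z ≠ k)
    (huv : u ≠ v) (huz : u ≠ z) (hvz : v ≠ z) :
    MeasurePreserving (fun x : ι → G => (x u - x k, x v - x k, x z - x k)) volume volume := by
  let φ : (ι → G) →+ G × G × G :=
    { toFun := fun x => (x u - x k, x v - x k, x z - x k), map_zero' := by simp,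
      map_add' := fun x y => by ext <;> simp <;> abel }
  have : Measure.IsAddHaarMeasure (volume : Measure (G × G × G)) :=
    inferInstanceAs (Measure.IsAddHaarMeasure
      ((volume : Measure G).prod ((volume : Measure G).prod (volume : Measure G))))
  refine AddMonoidHom.measurePreserving (f := φ) ?_ ?_ (by simp)
  · change Continuous fun x : ι → G => (x u - x k, x v - x k, x z - x k)
    fun_prop
  · rintro ⟨a, b, c⟩
    refine ⟨fun i => if i = u then a else if i = v then b else if i = z then c else 0, ?_⟩
    simp [φ, hu.symm, hv.symm, hz.symm, huv.symm, huz.symm, hvz.symm]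

end Haar

/-- Independence of the coins, in the form used once the positions are fixed. -/
lemma volume_pi_pi_forall_mem {n : ℕ} {I : Type*} [MeasureSpace I]
    [IsProbabilityMeasure (volume : Measure I)] (s : Finset (Fin n × Fin n))
    (S : Fin n × Fin n → Set I) :
    volume {U : Fin n → Fin n → I | ∀ e ∈ s, U e.1 e.2 ∈ S e} = ∏ e ∈ s, volume (S e) := by
  have : {U : Fin n → Fin n → I | ∀ e ∈ s, U e.1 e.2 ∈ S e} =
      univ.pi fun a => univ.pi fun b => if (a, b) ∈ s then S (a, b) else univ := by
    ext U
    simp only [mem_ofPred_eq, Set.mem_pi, mem_univ, true_implies, Prod.forall]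
    refine forall_congr' fun a => forall_congr' fun b => ?_
    by_cases h : (a, b) ∈ s <;> simp [h]
  rw [this, volume_pi_pi]
  simp_rw [volume_pi_pi]
  rw [← Finset.prod_product' Finset.univ Finset.univ
    (fun a b => volume (if (a, b) ∈ s then S (a, b) else univ))]
  have h2 : ∀ x : Fin n × Fin n, volume (if (x.1, x.2) ∈ s then S (x.1, x.2) else univ) =
      if x ∈ s then volume (S x) else 1 := by
    intro x; by_cases h : x ∈ s <;> simp [h]
  simp_rw [h2]
  rw [Finset.prod_ite_mem]
  simp

/-! ### Deterministic bounds for clustering coefficients. -/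

section Clustering

variable {V : Type*} [Fintype V] (G : SimpleGraph V)

lemma ncard_triangles_le (v : V) :
    {s : Finset V | G.IsNClique 3 s ∧ v ∈ s}.ncard ≤ (G.neighborSet v).ncard.choose 2 := by
  classical
  have hN : (G.neighborSet v).ncard = (G.neighborSet v).toFinset.card := by
    rw [Set.ncard_eq_toFinset_card']
  rw [hN, ← Finset.card_powersetCard, ← Set.ncard_coe_finset]
  refine Set.ncard_le_ncard_of_injOn (fun s => s.erase v) ?_ ?_ (Finset.finite_toSet _)
  · rintro s ⟨hs, hv⟩
    rw [Finset.mem_coe, Finset.mem_powersetCard]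
    constructor
    · intro a ha
      rw [Finset.mem_erase] at ha
      rw [Set.mem_toFinset, SimpleGraph.mem_neighborSet]
      exact hs.isClique hv ha.2 ha.1.symm
    · rw [Finset.card_erase_of_mem hv, hs.card_eq]
  · rintro s ⟨_, hv⟩ t ⟨_, hv'⟩ h
    have := congrArg (insert v) h
    simpa [Finset.insert_erase hv, Finset.insert_erase hv'] using this

omit [Fintype V] in
lemma ccVertex_nonneg (v : V) : 0 ≤ ccVertex G v := by
  unfold ccVertex
  split_ifs <;> positivity

lemma ccVertex_le_one (v : V) : ccVertex G v ≤ 1 := by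
  unfold ccVertex
  split_ifs with h
  · exact div_le_one_of_le₀ (by exact_mod_cast ncard_triangles_le G v) (by positivity)
  · exact zero_le_one

omit [Fintype V] in
-- The coefficient of `v` sees only edges at `v` and among its neighbours, and `k` is not one of
-- them in either graph.
lemma ccVertex_congr {G H : SimpleGraph V} {k : V} (h : ∀ a b, a ≠ k → b ≠ k →
    (G.Adj a b ↔ H.Adj a b)) {v : V} (hv : v ≠ k) (hG : ¬ G.Adj k v) (hH : ¬ H.Adj k v) :
    ccVertex G v = ccVertex H v := by
  have hadj : ∀ a, G.Adj v a ↔ H.Adj v a := by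
    intro a
    by_cases ha : a = k
    · subst ha
      exact ⟨fun h' => absurd h'.symm hG, fun h' => absurd h'.symm hH⟩
    · exact h v a hv ha
  have hN : G.neighborSet v = H.neighborSet v := by
    ext a; exact hadj a
  have aux : ∀ {G H : SimpleGraph V}, (∀ a b, a ≠ k → b ≠ k → (G.Adj a b ↔ H.Adj a b)) →
      ¬ G.Adj k v → ∀ s : Finset V, G.IsNClique 3 s ∧ v ∈ s → H.IsNClique 3 s ∧ v ∈ s := by
    rintro G H h hG s ⟨hs, hvs⟩
    have hk : k ∉ s := fun hk => hG (hs.isClique hk hvs hv.symm)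
    refine ⟨⟨fun a ha b hb hab => ?_, hs.card_eq⟩, hvs⟩
    exact (h a b (fun e => hk (e ▸ ha)) (fun e => hk (e ▸ hb))).1 (hs.isClique ha hb hab)
  have hT : {s : Finset V | G.IsNClique 3 s ∧ v ∈ s} = {s : Finset V | H.IsNClique 3 s ∧ v ∈ s} :=
    Set.ext fun s => ⟨aux h hG s, aux (fun a b ha hb => (h a b ha hb).symm) hH s⟩
  unfold ccVertex
  rw [hN, hT]

/-- If two graphs agree away from the vertex `k`, then the sums of their clustering coefficients
differ by at most one plus the degrees of `k`. -/
lemma abs_sum_ccVertex_sub_le {G H : SimpleGraph V} {k : V} (h : ∀ a b, a ≠ k → b ≠ k →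
    (G.Adj a b ↔ H.Adj a b)) :
    |∑ v, ccVertex G v - ∑ v, ccVertex H v| ≤
      1 + (G.neighborSet k).ncard + (H.neighborSet k).ncard := by
  classical
  rw [← Finset.sum_sub_distrib]
  refine (Finset.abs_sum_le_sum_abs _ _).trans ?_
  set T : Finset V := insert k ((G.neighborSet k).toFinset ∪ (H.neighborSet k).toFinset)
  have h1 : ∀ v ∈ Finset.univ, v ∉ T → |ccVertex G v - ccVertex H v| = 0 := by
    intro v _ hv
    simp only [T, Finset.mem_insert, Finset.mem_union, Set.mem_toFinset,
      SimpleGraph.mem_neighborSet, not_or] at hv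
    rw [ccVertex_congr h hv.1 hv.2.1 hv.2.2, sub_self, abs_zero]
  rw [← Finset.sum_subset (Finset.subset_univ T) h1]
  have h2 : ∀ v ∈ T, |ccVertex G v - ccVertex H v| ≤ 1 := by
    intro v _
    rw [abs_le]
    constructor <;> linarith [ccVertex_nonneg G v, ccVertex_le_one G v, ccVertex_nonneg H v,
      ccVertex_le_one H v]
  refine (Finset.sum_le_sum h2).trans ?_
  have h3 : T.card ≤ 1 + (G.neighborSet k).ncard + (H.neighborSet k).ncard := by
    rw [Set.ncard_eq_toFinset_card', Set.ncard_eq_toFinset_card']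
    have := Finset.card_insert_le k ((G.neighborSet k).toFinset ∪ (H.neighborSet k).toFinset)
    have := Finset.card_union_le (G.neighborSet k).toFinset (H.neighborSet k).toFinset
    simp only [T]
    omega
  rw [Finset.sum_const, nsmul_eq_mul, mul_one]
  exact_mod_cast h3

lemma le_ccVertex_of_triangle {v a b : V} (ha : G.Adj v a) (hb : G.Adj v b) (hab : G.Adj a b)
    {K : ℝ} (hK : (G.neighborSet v).ncard ≤ K) : 1 / K ^ 2 ≤ ccVertex G v := by
  classical
  have hd : 2 ≤ (G.neighborSet v).ncard := by
    rw [← Set.ncard_pair hab.ne]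
    refine Set.ncard_le_ncard ?_ (Set.toFinite _)
    rintro x (rfl | rfl)
    · exact ha
    · exact hb
  have ht : 1 ≤ {s : Finset V | G.IsNClique 3 s ∧ v ∈ s}.ncard := by
    rw [Nat.one_le_iff_ne_zero, ← Nat.pos_iff_ne_zero, Set.ncard_pos (Set.toFinite _)]
    refine ⟨{v, a, b}, ?_, by simp⟩
    rw [SimpleGraph.is3Clique_triple_iff]
    exact ⟨ha, hb, hab⟩
  have hc : 0 < (G.neighborSet v).ncard.choose 2 := Nat.choose_pos hd
  rw [ccVertex, if_pos hd]
  have hc2 : ((G.neighborSet v).ncard.choose 2 : ℝ) ≤ K ^ 2 := by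
    have h1 : (G.neighborSet v).ncard.choose 2 ≤ (G.neighborSet v).ncard ^ 2 :=
      Nat.choose_le_pow _ _
    calc ((G.neighborSet v).ncard.choose 2 : ℝ) ≤ ((G.neighborSet v).ncard : ℝ) ^ 2 := by
          exact_mod_cast h1
      _ ≤ K ^ 2 := by gcongr
  have hc' : (0 : ℝ) < ((G.neighborSet v).ncard.choose 2 : ℝ) := by exact_mod_cast hc
  have ht' : (1 : ℝ) ≤ ({s : Finset V | G.IsNClique 3 s ∧ v ∈ s}.ncard : ℝ) := by exact_mod_cast ht
  gcongr

/-- The vertex lies in a triangle. -/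
def InTriangle {V : Type*} (G : SimpleGraph V) (v : V) : Prop :=
  ∃ a b, G.Adj v a ∧ G.Adj v b ∧ G.Adj a b

open Classical in
-- The bound is linear in the triangle indicator and the degree, so expectations can be taken
-- without knowing their joint law. If the degree exceeds `K`, the left side is at most zero.
lemma indicator_triangle_sub_le_ccVertex (v : V) {K : ℝ} (hK : 0 < K) :
    1 / K ^ 2 * ((if InTriangle G v then 1 else 0) - (G.neighborSet v).ncard / K) ≤
      ccVertex G v := by
  have hdeg : (0 : ℝ) ≤ (G.neighborSet v).ncard := by positivity
  have hle : (if InTriangle G v then (1 : ℝ) else 0) ≤ 1 := by split_ifs <;> simp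
  by_cases hd : ((G.neighborSet v).ncard : ℝ) ≤ K
  · by_cases ht : InTriangle G v
    · obtain ⟨a, b, ha, hb, hab⟩ := ht
      refine le_trans ?_ (le_ccVertex_of_triangle G ha hb hab hd)
      refine mul_le_of_le_one_right (by positivity) ?_
      have : 0 ≤ ((G.neighborSet v).ncard : ℝ) / K := by positivity
      linarith
    · refine le_trans ?_ (ccVertex_nonneg G v)
      rw [if_neg ht]
      refine mul_nonpos_of_nonneg_of_nonpos (by positivity) ?_
      have : 0 ≤ ((G.neighborSet v).ncard : ℝ) / K := by positivity
      linarith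
  · refine le_trans ?_ (ccVertex_nonneg G v)
    refine mul_nonpos_of_nonneg_of_nonpos (by positivity) ?_
    have : 1 ≤ ((G.neighborSet v).ncard : ℝ) / K := by
      rw [one_le_div hK]; exact (not_le.1 hd).le
    linarith

end Clustering

/-! ### Measurability of graph functionals. -/

section Measurability

variable {d n : ℕ} {w : Fin n → ℝ} {p : Torus d → Torus d → ℝ → ℝ → ℝ}

lemma girg_adj_of_lt {ω : Sample d n} {u v : Fin n} (h : u < v) :
    (girg w p ω).Adj u v ↔ (ω.2 u v : ℝ) < p (ω.1 u) (ω.1 v) (w u) (w v) := by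
  simp [girg, SimpleGraph.fromRel_adj, h, h.ne, h.not_gt]

lemma girg_adj_iff {ω : Sample d n} {u v : Fin n} (h : u ≠ v) :
    (girg w p ω).Adj u v ↔ (ω.2 (min u v) (max u v) : ℝ) <
      p (ω.1 (min u v)) (ω.1 (max u v)) (w (min u v)) (w (max u v)) := by
  rcases lt_or_gt_of_ne h with h | h
  · rw [min_eq_left h.le, max_eq_right h.le, girg_adj_of_lt h]
  · rw [min_eq_right h.le, max_eq_left h.le, SimpleGraph.adj_comm, girg_adj_of_lt h]

lemma measurableSet_adj (hw : ∀ v, 0 < w v)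
    (hp : ∀ a > 0, ∀ b > 0, Measurable fun z : Torus d × Torus d => p z.1 z.2 a b)
    (u v : Fin n) : MeasurableSet {ω : Sample d n | (girg w p ω).Adj u v} := by
  by_cases h : u = v
  · subst h; simp
  · simp_rw [girg_adj_iff h]
    refine measurableSet_lt ?_ ?_
    · exact measurable_subtype_coe.comp ((measurable_pi_apply _).comp
        ((measurable_pi_apply _).comp measurable_snd))
    · have h1 : Measurable fun ω : Sample d n => (ω.1 (min u v), ω.1 (max u v)) :=
        ((measurable_pi_apply (min u v)).comp measurable_fst).prodMk
          ((measurable_pi_apply (max u v)).comp measurable_fst)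
      exact (hp _ (hw (min u v)) _ (hw (max u v))).comp h1

/-- There are finitely many graphs on `Fin n`, so with the discrete σ-algebra only the adjacency
events have to be measurable. -/
lemma measurable_comp_girg (hw : ∀ v, 0 < w v)
    (hp : ∀ a > 0, ∀ b > 0, Measurable fun z : Torus d × Torus d => p z.1 z.2 a b)
    {α : Type*} [MeasurableSpace α] (g : SimpleGraph (Fin n) → α) :
    Measurable fun ω : Sample d n => g (girg w p ω) := by
  let _ : MeasurableSpace (SimpleGraph (Fin n)) := ⊤
  have : Measurable fun ω : Sample d n => girg w p ω := by
    refine measurable_to_countable' fun H => ?_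
    have : (fun ω : Sample d n => girg w p ω) ⁻¹' {H} =
        ⋂ u, ⋂ v, {ω : Sample d n | (girg w p ω).Adj u v ↔ H.Adj u v} := by
      ext ω
      simp only [mem_preimage, mem_singleton_iff, mem_iInter, mem_ofPred_eq]
      constructor
      · rintro rfl; simp
      · intro h; ext u v; exact h u v
    rw [this]
    refine MeasurableSet.iInter fun u => MeasurableSet.iInter fun v => ?_
    by_cases h : H.Adj u v
    · simpa [h] using measurableSet_adj hw hp u v
    · simp only [h, iff_false]
      exact (measurableSet_adj hw hp u v).compl
  exact (measurable_from_top (f := g)).comp this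

end Measurability

instance isProbabilityMeasure_unitAddCircle :
    IsProbabilityMeasure (volume : Measure UnitAddCircle) := ⟨by simp⟩

/-! ### The volume function of a distance function. -/

section Volume

variable {d : ℕ} {dist : Torus d → ℝ}

lemma ballVol_nonneg (r : ℝ) : 0 ≤ ballVol dist r := ENNReal.toReal_nonneg

lemma ballVol_mono : Monotone (ballVol dist) := fun _ _ h =>
  ENNReal.toReal_mono (measure_ne_top _ _) (measure_mono fun _ hx => le_trans hx h)

lemma volume_ball (r : ℝ) : volume (ball dist r) = ENNReal.ofReal (ballVol dist r) :=
  (ENNReal.ofReal_toReal (measure_ne_top _ _)).symm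

/-- Since `V` may be constant on intervals, a radius of volume exactly `t` need not contain this
set. A radius of volume `s > t` does, and `s` then decreases to `t`. -/
lemma volume_ballVol_le (h : IsDistanceFunction dist) {t : ℝ} (ht : 0 ≤ t) :
    volume {x | ballVol dist (dist x) ≤ t} ≤ ENNReal.ofReal t := by
  rcases le_or_gt 1 t with h1 | h1
  · exact prob_le_one.trans (by simpa using h1)
  have hs : ∀ s ∈ Ioc t 1, volume {x | ballVol dist (dist x) ≤ t} ≤ ENNReal.ofReal s := by
    rintro s ⟨hts, hs1⟩
    obtain ⟨r, -, hr⟩ := h.surj ⟨ht.trans hts.le, hs1⟩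
    rw [← hr, ← volume_ball]
    refine measure_mono fun x hx => ?_
    by_contra hx'
    have h2 : r ≤ dist x := (not_le.1 hx').le
    have h3 := ballVol_mono (dist := dist) h2
    have h4 : ballVol dist (dist x) ≤ t := hx
    linarith
  have hlim : Tendsto (fun s : ℝ => ENNReal.ofReal s) (𝓝[>] t) (𝓝 (ENNReal.ofReal t)) :=
    (ENNReal.continuous_ofReal.tendsto t).mono_left nhdsWithin_le_nhds
  refine ge_of_tendsto hlim ?_
  filter_upwards [Ioc_mem_nhdsGT h1] with s hs' using hs s hs'

lemma ballVol_zero (h : IsDistanceFunction dist) : ballVol dist 0 = 0 := by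
  obtain ⟨r, hr, hr'⟩ := h.surj (show (0 : ℝ) ∈ Icc (0 : ℝ) 1 by simp)
  exact le_antisymm ((ballVol_mono (show 0 ≤ r from hr)).trans hr'.le) (ballVol_nonneg _)

/-- Makes coinciding positions negligible, where the edge probabilities have no lower bound. -/
lemma volume_singleton_zero (h : IsDistanceFunction dist) : volume {(0 : Torus d)} = 0 := by
  refine measure_mono_null (t := ball dist 0) ?_ ?_
  · rintro x rfl
    exact h.zero.le
  · rw [volume_ball, ballVol_zero h, ENNReal.ofReal_zero]

end Volume

/-! ### The connection kernel and its average over the torus. -/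

section Kernel

variable {α : ℝ}

lemma kernel_nonneg {n : ℕ} {a T : ℝ} (ha : 0 ≤ a) (hT : 0 ≤ T) : 0 ≤ kernel α n a T := by
  unfold kernel
  split_ifs
  · exact zero_le_one
  · exact le_min zero_le_one (by positivity)

lemma kernel_le_one {n : ℕ} {a T : ℝ} : kernel α n a T ≤ 1 := by
  unfold kernel
  split_ifs
  · exact le_rfl
  · exact min_le_left _ _

lemma kernel_eq_one {n : ℕ} {a T : ℝ} (hα : 0 ≤ α) (hT : 0 ≤ T) (hn : 0 < n) (h : n * T ≤ a) :
    kernel α n a T = 1 := by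
  unfold kernel
  split_ifs with h0
  · rfl
  · have hT' : 0 < T := lt_of_le_of_ne hT (Ne.symm h0)
    have hn' : (0 : ℝ) < n := by exact_mod_cast hn
    refine min_eq_left (Real.one_le_rpow ?_ hα)
    rwa [one_le_div (by positivity)]

/-- Here `k` is the dyadic scale of `T` relative to the saturation level `a / n`, with `k = 0` below
that level. -/
lemma exists_kernel_le {n : ℕ} {a T : ℝ} (hα : 0 ≤ α) (ha : 0 < a) (hn : 0 < n) :
    ∃ k : ℕ, T ≤ a / n * 2 ^ (k + 1) ∧ kernel α n a T ≤ ((2 : ℝ) ^ (-α)) ^ k := by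
  have hn' : (0 : ℝ) < n := by exact_mod_cast hn
  have hs : 0 < a / n := by positivity
  rcases lt_or_ge T (a / n) with h | h
  · exact ⟨0, by linarith, by simpa using kernel_le_one⟩
  · have hTpos : 0 < T := hs.trans_le h
    obtain ⟨k, hk1, hk2⟩ := exists_nat_pow_near ((one_le_div hs).2 h) (one_lt_two)
    refine ⟨k, ?_, ?_⟩
    · rw [div_lt_iff₀ hs] at hk2
      linarith
    · rw [kernel, if_neg hTpos.ne']
      refine (min_le_right _ _).trans ?_
      have e : ((2 : ℝ) ^ (-α)) ^ k = ((2 ^ k : ℝ)⁻¹) ^ α := by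
        rw [Real.rpow_neg (by norm_num), inv_pow, Real.inv_rpow (by positivity),
          ← Real.rpow_natCast, ← Real.rpow_natCast, ← Real.rpow_mul (by norm_num),
          ← Real.rpow_mul (by norm_num), mul_comm]
      rw [e]
      refine Real.rpow_le_rpow (by positivity) ?_ hα
      rw [le_div_iff₀ hs] at hk1
      rw [← one_div, div_le_div_iff₀ (by positivity) (by positivity)]
      have : 2 ^ k * (a / n) * n = 2 ^ k * a := by field_simp
      nlinarith

/-- The constant in the estimate for the average of the kernel over the torus. -/
noncomputable def kernelConst (α : ℝ) : ℝ := 2 / (1 - 2 * (2 : ℝ) ^ (-α))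

lemma two_mul_rpow_neg_lt_one (hα : 1 < α) : 2 * (2 : ℝ) ^ (-α) < 1 := by
  have : (2 : ℝ) ^ (-α) < 2 ^ (-1 : ℝ) := Real.rpow_lt_rpow_of_exponent_lt one_lt_two (by linarith)
  rw [Real.rpow_neg_one] at this
  linarith

lemma kernelConst_pos (hα : 1 < α) : 0 < kernelConst α :=
  div_pos two_pos (sub_pos.2 (two_mul_rpow_neg_lt_one hα))

variable {d : ℕ} {dist : Torus d → ℝ}

lemma measurable_ballVol_comp (h : IsDistanceFunction dist) :
    Measurable fun x => ballVol dist (dist x) :=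
  ballVol_mono.measurable.comp h.measurable

lemma measurable_kernel_comp (h : IsDistanceFunction dist) (n : ℕ) (a : ℝ) :
    Measurable fun x => kernel α n a (ballVol dist (dist x)) := by
  have hm := measurable_ballVol_comp h
  unfold kernel
  refine Measurable.ite (hm (measurableSet_singleton 0)) measurable_const ?_
  exact measurable_const.min ((measurable_const.div (measurable_const.mul hm)).pow_const α)

/-- At dyadic scale `k` the kernel is at most `2 ^ (-α k)` on a set of volume at most `(a / n) * 2 ^
(k + 1)`, and the resulting geometric series converges because `α > 1`. -/
lemma lintegral_kernel_le (h : IsDistanceFunction dist) (hα : 1 < α) {n : ℕ} {a : ℝ}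
    (hn : 0 < n) (ha : 0 < a) :
    ∫⁻ x, ENNReal.ofReal (kernel α n a (ballVol dist (dist x))) ≤
      ENNReal.ofReal (kernelConst α * (a / n)) := by
  have hn' : (0 : ℝ) < n := by exact_mod_cast hn
  set b : ℝ := (2 : ℝ) ^ (-α) with hb
  have hb0 : 0 < b := by positivity
  have hb1 : 2 * b < 1 := two_mul_rpow_neg_lt_one hα
  set A : ℕ → Set (Torus d) := fun k => {x | ballVol dist (dist x) ≤ a / n * 2 ^ (k + 1)} with hA
  have hAm : ∀ k, MeasurableSet (A k) := fun k =>
    measurableSet_le (measurable_ballVol_comp h) measurable_const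
  calc ∫⁻ x, ENNReal.ofReal (kernel α n a (ballVol dist (dist x)))
      ≤ ∫⁻ x, ∑' k : ℕ, (A k).indicator (fun _ => ENNReal.ofReal (b ^ k)) x := by
        refine lintegral_mono fun x => ?_
        obtain ⟨k, hk1, hk2⟩ := exists_kernel_le (α := α) (T := ballVol dist (dist x)) (by linarith) ha hn
        refine le_trans ?_ (ENNReal.le_tsum k)
        rw [indicator_of_mem (show x ∈ A k from hk1)]
        exact ENNReal.ofReal_le_ofReal hk2
    _ = ∑' k : ℕ, ENNReal.ofReal (b ^ k) * volume (A k) := by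
        rw [lintegral_tsum fun k => (measurable_const.indicator (hAm k)).aemeasurable]
        congr 1
        funext k
        rw [lintegral_indicator_const (hAm k)]
    _ ≤ ∑' k : ℕ, ENNReal.ofReal (a / n * 2 * (2 * b) ^ k) := by
        refine ENNReal.tsum_le_tsum fun k => ?_
        refine (mul_le_mul_right (volume_ballVol_le h (by positivity)) _).trans ?_
        rw [← ENNReal.ofReal_mul (by positivity)]
        refine ENNReal.ofReal_le_ofReal (le_of_eq ?_)
        rw [mul_pow, pow_succ]; ring
    _ = ENNReal.ofReal (kernelConst α * (a / n)) := by
        have hsum := (hasSum_geometric_of_lt_one (by positivity) hb1).mul_left (a / n * 2)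
        rw [← ENNReal.ofReal_tsum_of_nonneg (fun k => by positivity) hsum.summable, hsum.tsum_eq,
          kernelConst, ← hb]
        congr 1
        field_simp

end Kernel

/-! ### Probabilities of one and two edges at a vertex. -/

section Degree

variable {d n : ℕ} {w : Fin n → ℝ} {p : Torus d → Torus d → ℝ → ℝ → ℝ}

lemma volume_unitInterval_lt_le (c : ℝ) :
    volume {t : unitInterval | (t : ℝ) < c} ≤ ENNReal.ofReal c := by
  rcases le_or_gt 1 c with h1 | h1
  · exact prob_le_one.trans (by simpa using h1)
  rcases lt_or_ge c 0 with h0 | h0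
  · have : {t : unitInterval | (t : ℝ) < c} = ∅ := by
      ext t; simpa using h0.le.trans t.2.1
    simp [this]
  · exact (unitInterval.volume_Iio ⟨c, h0, h1.le⟩).le

lemma le_volume_unitInterval_lt {c : ℝ} (h0 : 0 ≤ c) (h1 : c ≤ 1) :
    ENNReal.ofReal c ≤ volume {t : unitInterval | (t : ℝ) < c} :=
  (unitInterval.volume_Iio ⟨c, h0, h1⟩).ge

/-- The coin of an unordered pair of vertices. -/
def coin (u v : Fin n) : Fin n × Fin n := (min u v, max u v)

lemma coin_comm (u v : Fin n) : coin u v = coin v u := by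
  simp [coin, min_comm, max_comm]

lemma coin_injective (k : Fin n) {u v : Fin n} (h : coin k u = coin k v) : u = v := by
  simp only [coin, Prod.mk.injEq] at h
  rcases le_total k u with hu | hu <;> rcases le_total k v with hv | hv <;>
    simp_all

/-- The edges at `k` are dominated by independent coins whose success probability depends only
on the relative position. -/
def DominatedAt (w : Fin n → ℝ) (p : Torus d → Torus d → ℝ → ℝ → ℝ) (k : Fin n)
    (h : Fin n → Torus d → ℝ) : Prop :=
  ∀ (ω : Sample d n) (u : Fin n), u ≠ k → (girg w p ω).Adj k u →
    (ω.2 (coin k u).1 (coin k u).2 : ℝ) < h u (ω.1 u - ω.1 k)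

variable {k : Fin n} {h : Fin n → Torus d → ℝ}

lemma volume_adj_le (H : DominatedAt w p k h) (hm : ∀ u, Measurable (h u)) {u : Fin n}
    (hu : u ≠ k) :
    volume {ω : Sample d n | (girg w p ω).Adj k u} ≤ ∫⁻ x, ENNReal.ofReal (h u x) := by
  set E : Set (Sample d n) := {ω | (ω.2 (coin k u).1 (coin k u).2 : ℝ) < h u (ω.1 u - ω.1 k)}
    with hE
  have hEm : MeasurableSet E := by
    refine measurableSet_lt ?_ ((hm u).comp ?_)
    · exact measurable_subtype_coe.comp ((measurable_pi_apply (coin k u).2).comp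
        ((measurable_pi_apply (coin k u).1).comp measurable_snd))
    · exact ((measurable_pi_apply u).comp measurable_fst).sub
        ((measurable_pi_apply k).comp measurable_fst)
  refine (measure_mono fun ω hω => H ω u hu hω : _ ≤ volume E).trans ?_
  rw [Measure.volume_eq_prod, Measure.prod_apply hEm]
  calc _ ≤ ∫⁻ x : Fin n → Torus d, ENNReal.ofReal (h u (x u - x k)) := by
        refine lintegral_mono fun x => ?_
        have := volume_pi_pi_forall_mem (I := unitInterval) {coin k u}
          (fun _ => {t : unitInterval | (t : ℝ) < h u (x u - x k)})
        simp only [Finset.mem_singleton, forall_eq, Finset.prod_singleton] at this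
        exact this.trans_le (volume_unitInterval_lt_le _)
    _ = _ := (measurePreserving_sub_apply (G := Torus d) hu).lintegral_comp
        (f := fun y => ENNReal.ofReal (h u y)) (hm u).ennreal_ofReal

/-- The two edges use distinct coins, and the positions of `u` and `v` relative to `k` are
independent, so the dominating events factorise. -/
lemma volume_adj_adj_le (H : DominatedAt w p k h) (hm : ∀ u, Measurable (h u)) {u v : Fin n}
    (hu : u ≠ k) (hv : v ≠ k) (huv : u ≠ v) :
    volume {ω : Sample d n | (girg w p ω).Adj k u ∧ (girg w p ω).Adj k v} ≤
      (∫⁻ x, ENNReal.ofReal (h u x)) * ∫⁻ x, ENNReal.ofReal (h v x) := by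
  set E : Fin n → Set (Sample d n) := fun u =>
    {ω | (ω.2 (coin k u).1 (coin k u).2 : ℝ) < h u (ω.1 u - ω.1 k)} with hE
  have hEm : ∀ u, MeasurableSet (E u) := by
    intro u
    refine measurableSet_lt ?_ ((hm u).comp ?_)
    · exact measurable_subtype_coe.comp ((measurable_pi_apply (coin k u).2).comp
        ((measurable_pi_apply (coin k u).1).comp measurable_snd))
    · exact ((measurable_pi_apply u).comp measurable_fst).sub
        ((measurable_pi_apply k).comp measurable_fst)
  refine (measure_mono fun ω hω => ⟨H ω u hu hω.1, H ω v hv hω.2⟩ :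
    _ ≤ volume (E u ∩ E v)).trans ?_
  rw [Measure.volume_eq_prod, Measure.prod_apply ((hEm u).inter (hEm v))]
  have hne : coin k u ≠ coin k v := fun e => huv (coin_injective k e)
  calc _ ≤ ∫⁻ x : Fin n → Torus d, ENNReal.ofReal (h u (x u - x k)) *
        ENNReal.ofReal (h v (x v - x k)) := by
        refine lintegral_mono fun x => ?_
        have := volume_pi_pi_forall_mem (I := unitInterval) {coin k u, coin k v}
          (fun e => if e = coin k u then {t : unitInterval | (t : ℝ) < h u (x u - x k)}
            else {t : unitInterval | (t : ℝ) < h v (x v - x k)})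
        rw [Finset.prod_pair hne, if_pos rfl, if_neg hne.symm] at this
        simp only [Finset.mem_insert, Finset.mem_singleton, forall_eq_or_imp, forall_eq,
          if_true, if_neg hne.symm] at this
        exact this.trans_le (mul_le_mul' (volume_unitInterval_lt_le _)
          (volume_unitInterval_lt_le _))
    _ = ∫⁻ y : Torus d × Torus d, ENNReal.ofReal (h u y.1) * ENNReal.ofReal (h v y.2) :=
        (measurePreserving_sub_apply₂ (G := Torus d) hu hv huv).lintegral_comp
          (f := fun y => ENNReal.ofReal (h u y.1) * ENNReal.ofReal (h v y.2))
          (((hm u).comp measurable_fst).ennreal_ofReal.mul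
            ((hm v).comp measurable_snd).ennreal_ofReal)
    _ = _ := by
        rw [Measure.volume_eq_prod]
        exact lintegral_prod_mul (f := fun y => ENNReal.ofReal (h u y))
          (g := fun y => ENNReal.ofReal (h v y)) (hm u).ennreal_ofReal.aemeasurable
          (hm v).ennreal_ofReal.aemeasurable

open Classical in
lemma ncard_neighborSet_eq_sum (G : SimpleGraph (Fin n)) (k : Fin n) :
    ((G.neighborSet k).ncard : ℝ) = ∑ u, if G.Adj k u then (1 : ℝ) else 0 := by
  rw [Set.ncard_eq_toFinset_card', Finset.sum_boole]
  congr 2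
  ext u
  simp

lemma integral_ite_eq_measureReal {Ω : Type*} [MeasurableSpace Ω] {μ : Measure Ω} {P : Ω → Prop}
    [DecidablePred P] (hP : MeasurableSet {ω | P ω}) :
    ∫ ω, (if P ω then (1 : ℝ) else 0) ∂μ = μ.real {ω | P ω} := by
  have : (fun ω => if P ω then (1 : ℝ) else 0) = {ω | P ω}.indicator 1 := by
    ext ω; simp [indicator_apply]
  rw [this, integral_indicator_one hP]

variable (hw : ∀ v, 0 < w v)
  (hp : ∀ a > 0, ∀ b > 0, Measurable fun z : Torus d × Torus d => p z.1 z.2 a b)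

include hw hp in
lemma integrable_comp_girg (g : SimpleGraph (Fin n) → ℝ) :
    Integrable (fun ω : Sample d n => g (girg w p ω)) := by
  have : Finite (SimpleGraph (Fin n)) := inferInstance
  obtain ⟨B, hB⟩ := (Set.finite_range fun G => |g G|).bddAbove
  exact integrable_of_abs_le (measurable_comp_girg hw hp g) (B := B) fun ω => hB ⟨_, rfl⟩

end Degree

/-! ### First and second moments of the degrees. -/

section Moments

variable {d n : ℕ} {w : Fin n → ℝ} {p : Torus d → Torus d → ℝ → ℝ → ℝ} {k : Fin n}
  {h : Fin n → Torus d → ℝ} {q : Fin n → ℝ} (hw : ∀ v, 0 < w v)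
  (hp : ∀ a > 0, ∀ b > 0, Measurable fun z : Torus d × Torus d => p z.1 z.2 a b)
  (H : DominatedAt w p k h) (hm : ∀ u, Measurable (h u)) (hq0 : ∀ u, 0 ≤ q u)
  (hq : ∀ u, ∫⁻ x, ENNReal.ofReal (h u x) ≤ ENNReal.ofReal (q u))

include H hm hq0 hq in
lemma measureReal_adj_le (u : Fin n) :
    (volume : Measure (Sample d n)).real {ω | (girg w p ω).Adj k u} ≤ q u := by
  by_cases hu : u = k
  · subst hu; simpa using hq0 u
  · exact ENNReal.toReal_le_of_le_ofReal (hq0 u) ((volume_adj_le H hm hu).trans (hq u))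

include H hm hq0 hq in
lemma measureReal_adj_adj_le {u v : Fin n} (huv : u ≠ v) :
    (volume : Measure (Sample d n)).real
      {ω | (girg w p ω).Adj k u ∧ (girg w p ω).Adj k v} ≤ q u * q v := by
  by_cases hu : u = k
  · subst hu; simpa using mul_nonneg (hq0 u) (hq0 v)
  by_cases hv : v = k
  · subst hv; simpa using mul_nonneg (hq0 u) (hq0 v)
  refine ENNReal.toReal_le_of_le_ofReal (mul_nonneg (hq0 u) (hq0 v)) ?_
  rw [ENNReal.ofReal_mul (hq0 u)]
  exact (volume_adj_adj_le H hm hu hv huv).trans (mul_le_mul' (hq u) (hq v))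

include hw hp H hm hq0 hq in
lemma integral_degree_le :
    ∫ ω : Sample d n, (((girg w p ω).neighborSet k).ncard : ℝ) ≤ ∑ u, q u := by
  classical
  simp_rw [ncard_neighborSet_eq_sum]
  rw [integral_finsetSum _ fun u _ => integrable_comp_girg hw hp
    (fun G => if G.Adj k u then (1 : ℝ) else 0)]
  refine Finset.sum_le_sum fun u _ => ?_
  exact (integral_ite_eq_measureReal (measurableSet_adj hw hp k u)).trans_le
    (measureReal_adj_le H hm hq0 hq u)

include hw hp H hm hq0 hq in
-- Expand the square over pairs of neighbours: the diagonal gives the first moment, and the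
-- off-diagonal terms factorise.
lemma integral_degree_sq_le :
    ∫ ω : Sample d n, (((girg w p ω).neighborSet k).ncard : ℝ) ^ 2 ≤
      ∑ u, q u + (∑ u, q u) ^ 2 := by
  classical
  have e : ∀ G : SimpleGraph (Fin n), ((G.neighborSet k).ncard : ℝ) ^ 2 =
      ∑ u, ∑ v, if G.Adj k u ∧ G.Adj k v then (1 : ℝ) else 0 := by
    intro G
    rw [ncard_neighborSet_eq_sum, sq, Finset.sum_mul_sum]
    refine Finset.sum_congr rfl fun u _ => Finset.sum_congr rfl fun v _ => ?_
    by_cases h1 : G.Adj k u <;> by_cases h2 : G.Adj k v <;> simp [h1, h2]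
  simp_rw [e]
  rw [integral_finsetSum _ fun u _ => integrable_comp_girg hw hp
    (fun G => ∑ v, if G.Adj k u ∧ G.Adj k v then (1 : ℝ) else 0)]
  have hb : ∀ u v, ∫ ω : Sample d n,
      (if (girg w p ω).Adj k u ∧ (girg w p ω).Adj k v then (1 : ℝ) else 0) ≤
      (if u = v then q u else 0) + q u * q v := by
    intro u v
    rw [integral_ite_eq_measureReal
      (P := fun ω : Sample d n => (girg w p ω).Adj k u ∧ (girg w p ω).Adj k v)
      ((measurableSet_adj hw hp k u).inter (measurableSet_adj hw hp k v))]
    by_cases huv : u = v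
    · subst huv
      simp only [and_self, if_true]
      have := measureReal_adj_le H hm hq0 hq u
      have := mul_nonneg (hq0 u) (hq0 u)
      linarith
    · rw [if_neg huv, zero_add]
      exact measureReal_adj_adj_le H hm hq0 hq huv
  calc _ ≤ ∑ u, ∑ v, ((if u = v then q u else 0) + q u * q v) := by
        refine Finset.sum_le_sum fun u _ => ?_
        rw [integral_finsetSum _ fun v _ => integrable_comp_girg hw hp
          (fun G => if G.Adj k u ∧ G.Adj k v then (1 : ℝ) else 0)]
        exact Finset.sum_le_sum fun v _ => hb u v
    _ = _ := by
        simp_rw [Finset.sum_add_distrib, Finset.sum_ite_eq, Finset.mem_univ, if_true]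
        rw [sq, Finset.sum_mul_sum]

end Moments

/-! ### Variance of the sum of clustering coefficients. -/

section Variance

lemma measurePreserving_mix {ι Ξ : Type*} [Fintype ι] [DecidableEq ι] [MeasurableSpace Ξ]
    (μ : Measure Ξ) [IsProbabilityMeasure μ] (s : Finset ι) :
    MeasurePreserving (mix (Ξ := Ξ) s) (Measure.pi fun _ : ι => μ.prod μ)
      (Measure.pi fun _ : ι => μ) := by
  have h : ∀ i : ι, MeasurePreserving (fun y : Ξ × Ξ => if i ∈ s then y.2 else y.1)
      (μ.prod μ) μ := by
    intro i
    by_cases hi : i ∈ s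
    · simpa only [hi, if_true] using measurePreserving_snd
    · simpa only [hi, if_false] using measurePreserving_fst
  exact measurePreserving_pi _ _ h

variable {d n : ℕ} {w : Fin n → ℝ} {p : Torus d → Torus d → ℝ → ℝ → ℝ}

/-- The vertices together with their rows of coins are independent. -/
abbrev rowEquiv (d n : ℕ) : (Fin n → Torus d × (Fin n → unitInterval)) ≃ᵐ Sample d n :=
  MeasurableEquiv.arrowProdEquivProdArrow (Torus d) (Fin n → unitInterval) (Fin n)

lemma measurePreserving_rowEquiv (d n : ℕ) :
    MeasurePreserving (rowEquiv d n) (Measure.pi fun _ => volume) volume :=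
  measurePreserving_arrowProdEquivProdArrow (Torus d) (Fin n → unitInterval) (Fin n)
    (fun _ => volume) (fun _ => volume)

/-- The coin of a pair is stored in the row of its smaller vertex, so resampling the data of `k`
affects no pair avoiding `k`. -/
lemma girg_adj_mix_iff (z : Fin n → (Torus d × (Fin n → unitInterval)) ×
    (Torus d × (Fin n → unitInterval))) {k a b : Fin n} (ha : a ≠ k) (hb : b ≠ k) :
    (girg w p (rowEquiv d n (mix ∅ z))).Adj a b ↔
      (girg w p (rowEquiv d n (mix {k} z))).Adj a b := by
  have key : ∀ c, c ≠ k → mix ∅ z c = mix {k} z c := fun c hc => by simp [mix, hc]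
  by_cases hab : a = b
  · subst hab; simp
  have h1 : min a b ≠ k := by rcases min_choice a b with h | h <;> rwa [h]
  have h2 : max a b ≠ k := by rcases max_choice a b with h | h <;> rwa [h]
  rw [girg_adj_iff hab, girg_adj_iff hab]
  change ((mix ∅ z (min a b)).2 (max a b) : ℝ) < p (mix ∅ z (min a b)).1 (mix ∅ z (max a b)).1 _ _ ↔
    ((mix {k} z (min a b)).2 (max a b) : ℝ) < p (mix {k} z (min a b)).1 (mix {k} z (max a b)).1 _ _
  rw [key _ h1, key _ h2]

/-- The variance of the sum of the clustering coefficients is controlled by the second moments of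
the degrees. -/
lemma variance_sum_ccVertex_le (hw : ∀ v, 0 < w v)
    (hp : ∀ a > 0, ∀ b > 0, Measurable fun z : Torus d × Torus d => p z.1 z.2 a b) :
    ProbabilityTheory.variance (fun ω : Sample d n => ∑ v, ccVertex (girg w p ω) v) volume ≤
      3 / 2 * ∑ k, (1 + 2 * ∫ ω : Sample d n, (((girg w p ω).neighborSet k).ncard : ℝ) ^ 2) := by
  set F : Sample d n → ℝ := fun ω => ∑ v, ccVertex (girg w p ω) v with hF
  have hFm : Measurable F := measurable_comp_girg hw hp fun G => ∑ v, ccVertex G v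
  have hFB : ∀ ω, |F ω| ≤ n := by
    intro ω
    rw [abs_of_nonneg (Finset.sum_nonneg fun v _ => ccVertex_nonneg _ v)]
    refine (Finset.sum_le_sum fun v _ => ccVertex_le_one _ v).trans ?_
    simp
  have he := measurePreserving_rowEquiv d n
  have hv : ProbabilityTheory.variance F volume =
      ProbabilityTheory.variance (F ∘ rowEquiv d n) (Measure.pi fun _ => volume) := by
    conv_lhs => rw [← he.map_eq]
    exact ProbabilityTheory.variance_map hFm.aemeasurable he.measurable.aemeasurable
  rw [hv]
  refine (variance_le_sum_resample (volume : Measure (Torus d × (Fin n → unitInterval)))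
    (hFm.comp (rowEquiv d n).measurable) (B := n) fun x => hFB _).trans ?_
  have hk : ∀ k : Fin n, ∫ z, ((F ∘ rowEquiv d n) (mix ∅ z) - (F ∘ rowEquiv d n) (mix {k} z)) ^ 2
      ∂(Measure.pi fun _ : Fin n => (volume : Measure (Torus d × (Fin n → unitInterval))).prod
        volume) ≤
      3 * (1 + 2 * ∫ ω : Sample d n, (((girg w p ω).neighborSet k).ncard : ℝ) ^ 2) := by
    intro k
    set D : Sample d n → ℝ := fun ω => (((girg w p ω).neighborSet k).ncard : ℝ) ^ 2 with hD
    have hDi : Integrable D := integrable_comp_girg hw hp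
      fun G => (((G.neighborSet k).ncard : ℝ) ^ 2)
    have hDm : Measurable D := measurable_comp_girg hw hp
      fun G => (((G.neighborSet k).ncard : ℝ) ^ 2)
    have hpres : ∀ s, MeasurePreserving (fun z => rowEquiv d n (mix s z))
        (Measure.pi fun _ : Fin n => (volume : Measure (Torus d × (Fin n → unitInterval))).prod
        volume) volume := fun s => he.comp (measurePreserving_mix _ s)
    have hi : ∀ s, Integrable (fun z => D (rowEquiv d n (mix s z)))
        (Measure.pi fun _ : Fin n => (volume : Measure (Torus d × (Fin n → unitInterval))).prod
        volume) := fun s => (hpres s).integrable_comp_of_integrable hDi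
    have hI : ∀ s, ∫ z, D (rowEquiv d n (mix s z))
        ∂(Measure.pi fun _ : Fin n => (volume : Measure (Torus d × (Fin n → unitInterval))).prod
        volume) = ∫ ω, D ω := by
      intro s
      conv_rhs => rw [← (hpres s).map_eq]
      rw [integral_map (hpres s).measurable.aemeasurable hDm.aestronglyMeasurable]
    calc _ ≤ ∫ z, 3 * (1 + (D (rowEquiv d n (mix ∅ z)) + D (rowEquiv d n (mix {k} z))))
        ∂(Measure.pi fun _ : Fin n => (volume : Measure (Torus d × (Fin n → unitInterval))).prod
        volume) := by
          refine integral_mono_of_nonneg (Eventually.of_forall fun z => sq_nonneg _)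
            (((integrable_const 1).add ((hi ∅).add (hi {k}))).const_mul 3)
            (Eventually.of_forall fun z => ?_)
          have h1 := abs_sum_ccVertex_sub_le (k := k)
            (G := girg w p (rowEquiv d n (mix ∅ z)))
            (H := girg w p (rowEquiv d n (mix {k} z)))
            fun a b ha hb => girg_adj_mix_iff z ha hb
          simp only [Function.comp_apply, hF, hD]
          rw [← sq_abs]
          set a : ℝ := (((girg w p (rowEquiv d n (mix ∅ z))).neighborSet k).ncard : ℝ)
          set b : ℝ := (((girg w p (rowEquiv d n (mix {k} z))).neighborSet k).ncard : ℝ)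
          refine (pow_le_pow_left₀ (abs_nonneg _) h1 2).trans ?_
          -- This is `(1 + a + b) ^ 2 ≤ 3 * (1 + a ^ 2 + b ^ 2)`.
          nlinarith [sq_nonneg (1 - a), sq_nonneg (1 - b), sq_nonneg (a - b)]
      _ = _ := by
          have t1 := integral_add (integrable_const (1 : ℝ)) ((hi ∅).add (hi {k}))
          have t2 := integral_add (hi ∅) (hi {k})
          simp only [Pi.add_apply] at t1
          rw [integral_const_mul, t1, t2, hI, hI]
          simp
          ring
  calc _ ≤ 1 / 2 * ∑ k : Fin n, 3 *
        (1 + 2 * ∫ ω : Sample d n, (((girg w p ω).neighborSet k).ncard : ℝ) ^ 2) := by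
        gcongr with k _
        exact hk k
    _ = _ := by
        rw [← Finset.mul_sum]; ring

end Variance

/-! ### Total weight and sum of squared weights under the power law. -/

section Weights

lemma le_sum_dyadic {μ x : ℝ} (hμ : 0 < μ) (hx : μ ≤ x) {N : ℕ} (hN : x < μ * 2 ^ N) :
    x ≤ ∑ k ∈ Finset.range N, μ * 2 ^ (k + 1) * if μ * 2 ^ k ≤ x then (1 : ℝ) else 0 := by
  obtain ⟨k, hk1, hk2⟩ := exists_nat_pow_near ((one_le_div hμ).2 hx) (one_lt_two)
  rw [le_div_iff₀ hμ, mul_comm] at hk1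
  rw [div_lt_iff₀ hμ, mul_comm] at hk2
  have hkN : k < N := by
    have : (2 : ℝ) ^ k < 2 ^ N := lt_of_mul_lt_mul_left (hk1.trans_lt hN) hμ.le
    exact (pow_lt_pow_iff_right₀ one_lt_two).1 this
  refine le_trans ?_ (Finset.single_le_sum (fun i _ => ?_) (Finset.mem_range.2 hkN))
  · rw [if_pos hk1, mul_one]
    exact hk2.le
  · split_ifs <;> positivity

lemma numGE_eq_sum {n : ℕ} (w : Fin n → ℝ) (t : ℝ) :
    (numGE w t : ℝ) = ∑ v, if t ≤ w v then (1 : ℝ) else 0 := by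
  classical
  rw [numGE, Set.ncard_eq_toFinset_card', Finset.sum_boole]
  congr 2
  ext v
  simp

/-- A one-sided power law with exponent `γ > 1` for the tail bounds the total weight. -/
lemma sum_weights_le {n : ℕ} {w : Fin n → ℝ} {m μ c γ : ℝ} (hm : 0 < m) (hmμ : m ≤ μ)
    (hμ : ∀ v, μ ≤ w v) (hc : 0 < c) (hγ : 1 < γ)
    (hw : ∀ t, μ ≤ t → (numGE w t : ℝ) ≤ c * (n / t ^ γ)) :
    ∑ v, w v ≤ 2 * c * m ^ (1 - γ) / (1 - (2 : ℝ) ^ (1 - γ)) * n := by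
  have hμ0 : 0 < μ := hm.trans_le hmμ
  obtain ⟨N, hN⟩ := pow_unbounded_of_one_lt ((∑ v, w v) / μ) (one_lt_two)
  rw [div_lt_iff₀ hμ0, mul_comm] at hN
  have hw0 : ∀ v, 0 ≤ w v := fun v => hμ0.le.trans (hμ v)
  have hr0 : 0 < (2 : ℝ) ^ (1 - γ) := by positivity
  have hr1 : (2 : ℝ) ^ (1 - γ) < 1 := Real.rpow_lt_one_of_one_lt_of_neg one_lt_two (by linarith)
  calc ∑ v, w v ≤ ∑ v, ∑ k ∈ Finset.range N, μ * 2 ^ (k + 1) *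
        (if μ * 2 ^ k ≤ w v then (1 : ℝ) else 0) :=
        Finset.sum_le_sum fun v _ => le_sum_dyadic hμ0 (hμ v)
          ((Finset.single_le_sum (fun i _ => hw0 i) (Finset.mem_univ v)).trans_lt hN)
    _ = ∑ k ∈ Finset.range N, μ * 2 ^ (k + 1) * numGE w (μ * 2 ^ k) := by
        rw [Finset.sum_comm]
        simp_rw [numGE_eq_sum, Finset.mul_sum]
    _ ≤ ∑ k ∈ Finset.range N, 2 * c * m ^ (1 - γ) * n * ((2 : ℝ) ^ (1 - γ)) ^ k := by
        refine Finset.sum_le_sum fun k _ => ?_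
        have h1 : (1 : ℝ) ≤ 2 ^ k := one_le_pow₀ one_le_two
        have h2 := hw (μ * 2 ^ k) (le_mul_of_one_le_right hμ0.le h1)
        have h3 : (0 : ℝ) < μ * 2 ^ k := by positivity
        -- The lower bound `μ` may vary with `n`; replacing it by `m` keeps the constant uniform.
        have h4 : μ ^ (1 - γ) ≤ m ^ (1 - γ) :=
          Real.rpow_le_rpow_of_nonpos hm hmμ (by linarith)
        calc μ * 2 ^ (k + 1) * (numGE w (μ * 2 ^ k) : ℝ)
            ≤ μ * 2 ^ (k + 1) * (c * (n / (μ * 2 ^ k) ^ γ)) := by gcongr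
          _ = 2 * c * n * (μ * 2 ^ k) ^ (1 - γ) := by
              rw [Real.rpow_sub h3, Real.rpow_one]; ring
          _ = 2 * c * n * (μ ^ (1 - γ) * ((2 : ℝ) ^ (1 - γ)) ^ k) := by
              rw [Real.mul_rpow hμ0.le (by positivity), ← Real.rpow_natCast 2 k,
                ← Real.rpow_mul (by norm_num), mul_comm (k : ℝ), Real.rpow_mul (by norm_num),
                Real.rpow_natCast]
          _ ≤ 2 * c * n * (m ^ (1 - γ) * ((2 : ℝ) ^ (1 - γ)) ^ k) := by gcongr
          _ = _ := by ring
    _ ≤ 2 * c * m ^ (1 - γ) * n * (1 - (2 : ℝ) ^ (1 - γ))⁻¹ := by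
        rw [← Finset.mul_sum]
        have h5 := (summable_geometric_of_lt_one hr0.le hr1).sum_le_tsum (Finset.range N)
          fun i _ => by positivity
        rw [tsum_geometric_of_lt_one hr0.le hr1] at h5
        gcongr
    _ = _ := by ring

/-- The vertex `v` itself is counted at level `w v`, so the tail bound there is at least `1`. -/
lemma weight_le {n : ℕ} {w : Fin n → ℝ} {c γ : ℝ} (hγ : 1 < γ) (hw0 : ∀ v, 0 < w v) (v : Fin n)
    (hw : (numGE w (w v) : ℝ) ≤ c * (n / w v ^ γ)) : w v ≤ (c * n) ^ (1 / γ) := by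
  have h1 : 0 < numGE w (w v) :=
    (Set.ncard_pos (Set.toFinite _)).2 ⟨v, show w v ≤ w v from le_rfl⟩
  have h2 : (1 : ℝ) ≤ numGE w (w v) := by exact_mod_cast h1
  have h3 : 0 < w v ^ γ := Real.rpow_pos_of_pos (hw0 v) _
  have h4 : w v ^ γ ≤ c * n := by
    have := h2.trans hw
    rwa [← mul_div_assoc, one_le_div h3] at this
  calc w v = (w v ^ γ) ^ (1 / γ) := by
        rw [← Real.rpow_mul (hw0 v).le, mul_one_div_cancel (by linarith), Real.rpow_one]
    _ ≤ _ := Real.rpow_le_rpow h3.le h4 (by positivity)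

/-- The consequences of the weak power law that matter for clustering. -/
lemma IsPowerLawWeights.exists_bounds {β : ℝ} {w : ∀ n : ℕ, Fin n → ℝ} (hβ : 2 < β)
    (hw : IsPowerLawWeights β w) :
    ∃ m > 0, ∃ W > 0, (∀ᶠ n : ℕ in atTop, ∀ v, m ≤ w n v) ∧
      (∀ᶠ n : ℕ in atTop, ∑ v, w n v ≤ W * n) ∧
      Tendsto (fun n : ℕ => (∑ v, w n v ^ 2) / (n : ℝ) ^ 2) atTop (𝓝 0) := by
  obtain ⟨m, hm, hmin⟩ := hw.min_weight
  obtain ⟨_, -, hlaw⟩ := hw.power_law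
  -- This `η` gives the tail exponent `γ = β / 2 > 1`.
  obtain ⟨_, -, c, hc, hlaw⟩ := hlaw ((β - 2) / 2) (by linarith)
  set γ : ℝ := β - 1 - (β - 2) / 2 with hγ
  have hγ1 : 1 < γ := by rw [hγ]; linarith
  have hinf : ∀ n v, (⨅ v, w n v) ≤ w n v := fun n v => ciInf_le (Set.finite_range _).bddBelow v
  have hr1 : (2 : ℝ) ^ (1 - γ) < 1 := Real.rpow_lt_one_of_one_lt_of_neg one_lt_two (by linarith)
  set W : ℝ := 2 * c * m ^ (1 - γ) / (1 - (2 : ℝ) ^ (1 - γ)) with hW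
  have hWpos : 0 < W := div_pos (by positivity) (by linarith)
  have hsum : ∀ᶠ n : ℕ in atTop, ∑ v, w n v ≤ W * n := by
    filter_upwards [hmin, hlaw] with n h1 h2
    exact sum_weights_le hm h1 (hinf n) hc hγ1 h2.2
  refine ⟨m, hm, W, hWpos, ?_, hsum, ?_⟩
  · filter_upwards [hmin] with n h1 v using h1.trans (hinf n v)
  have hlim : Tendsto (fun n : ℕ => c ^ (1 / γ) * W * (n : ℝ) ^ (-(1 - 1 / γ))) atTop (𝓝 0) := by
    have h1 : 0 < 1 - 1 / γ := by
      rw [sub_pos, div_lt_one (by linarith)]; exact hγ1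
    simpa using ((tendsto_rpow_neg_atTop h1).comp tendsto_natCast_atTop_atTop).const_mul
      (c ^ (1 / γ) * W)
  refine squeeze_zero' (Eventually.of_forall fun n => by positivity) ?_ hlim
  filter_upwards [hsum, hlaw, eventually_gt_atTop 0] with n h1 h2 hn
  have hn' : (0 : ℝ) < n := by exact_mod_cast hn
  rw [div_le_iff₀ (by positivity)]
  -- Bound one factor by the largest weight, which is `O(n ^ (1 / γ))`, and sum the other.
  calc ∑ v, w n v ^ 2 ≤ ∑ v, (c * n) ^ (1 / γ) * w n v := by
        refine Finset.sum_le_sum fun v _ => ?_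
        rw [sq]
        exact mul_le_mul_of_nonneg_right
          (weight_le hγ1 (hw.pos n) v (h2.2 _ (hinf n v))) (hw.pos n v).le
    _ ≤ (c * n) ^ (1 / γ) * (W * n) := by
        rw [← Finset.mul_sum]
        gcongr
    _ = _ := by
        rw [Real.mul_rpow hc.le hn'.le, neg_sub, Real.rpow_sub hn', Real.rpow_one]
        field_simp

end Weights

/-! ### The stochastic triangle inequality for small radii. -/

section StochasticTriangle

variable {d : ℕ} {dist : Torus d → ℝ}

lemma volume_near_pair (h : IsDistanceFunction dist) (ε s : ℝ) :
    ((ProbabilityTheory.cond volume (ball dist ε)).prod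
        (ProbabilityTheory.cond volume (ball dist ε)))
          {z : Torus d × Torus d | dist (z.1 - z.2) ≤ s} =
      (volume (ball dist ε))⁻¹ * ((volume (ball dist ε))⁻¹ *
        volume {z : Torus d × Torus d | dist z.1 ≤ ε ∧ dist z.2 ≤ ε ∧ dist (z.1 - z.2) ≤ s}) := by
  have hS : MeasurableSet {z : Torus d × Torus d | dist (z.1 - z.2) ≤ s} :=
    measurableSet_le (h.measurable.comp (measurable_fst.sub measurable_snd)) measurable_const
  rw [ProbabilityTheory.cond, Measure.prod_smul_left, Measure.prod_smul_right,
    Measure.prod_restrict, Measure.smul_apply, Measure.smul_apply, Measure.restrict_apply hS,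
    smul_eq_mul, smul_eq_mul, ← Measure.volume_eq_prod]
  congr 3
  ext z
  simp only [mem_inter_iff, mem_ofPred_eq, mem_prod, ball]
  tauto

lemma StochasticTriangleInequality.exists_const (h : IsDistanceFunction dist)
    (hs : StochasticTriangleInequality dist) :
    ∃ C > 0, ∃ q > 0, q ≤ 1 ∧ ∀ᶠ ε : ℝ in 𝓝[>] 0, 0 < ballVol dist ε ∧
      q * ballVol dist (C * ε) ≤ ballVol dist ε ∧
      ENNReal.ofReal (q * ballVol dist ε ^ 2) ≤ volume {z : Torus d × Torus d |
        dist z.1 ≤ ε ∧ dist z.2 ≤ ε ∧ dist (z.1 - z.2) ≤ C * ε} := by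
  obtain ⟨C, hC, h1, h2⟩ := hs
  obtain ⟨q1, hq1, hq1'⟩ := exists_between h1
  obtain ⟨q2, hq2, hq2'⟩ := exists_between h2
  -- One constant serves both lower limits; the cap at `1` keeps it finite.
  have hq0 : 0 < min (min q1 q2) 1 := lt_min (lt_min hq1 hq2) one_pos
  have hqt : min (min q1 q2) 1 ≠ ⊤ := ne_top_of_le_ne_top ENNReal.one_ne_top (min_le_right _ _)
  refine ⟨C, hC, (min (min q1 q2) 1).toReal, ENNReal.toReal_pos hq0.ne' hqt,
    ENNReal.toReal_le_of_le_ofReal zero_le_one (by simp), ?_⟩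
  filter_upwards [eventually_lt_of_lt_liminf hq1', eventually_lt_of_lt_liminf hq2'] with ε e1 e2
  set q := min (min q1 q2) 1 with hq
  have e1' : q ≤ _ := ((min_le_left _ _).trans (min_le_left _ _)).trans e1.le
  have e2' : q ≤ _ := ((min_le_left _ _).trans (min_le_right _ _)).trans e2.le
  have hb : volume (ball dist ε) ≠ 0 := by
    intro hb
    rw [hb, ENNReal.zero_div] at e2
    exact not_lt_bot e2
  have hbt : volume (ball dist ε) ≠ ⊤ := measure_ne_top _ _
  refine ⟨ENNReal.toReal_pos hb hbt, ?_, ?_⟩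
  · have := ENNReal.mul_le_of_le_div e2'
    rw [ballVol, ballVol, ← ENNReal.toReal_mul]
    exact ENNReal.toReal_mono hbt this
  · rw [volume_near_pair h] at e1'
    rw [ENNReal.ofReal_mul ENNReal.toReal_nonneg, ENNReal.ofReal_toReal hqt,
      ENNReal.ofReal_pow (ballVol_nonneg _), ← volume_ball]
    calc q * volume (ball dist ε) ^ 2 ≤ ((volume (ball dist ε))⁻¹ * ((volume (ball dist ε))⁻¹ *
        volume {z : Torus d × Torus d | dist z.1 ≤ ε ∧ dist z.2 ≤ ε ∧ dist (z.1 - z.2) ≤ C * ε})) *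
          volume (ball dist ε) ^ 2 := by gcongr
      _ = (volume (ball dist ε) * (volume (ball dist ε))⁻¹) *
          (volume (ball dist ε) * (volume (ball dist ε))⁻¹) * volume {z : Torus d × Torus d |
            dist z.1 ≤ ε ∧ dist z.2 ≤ ε ∧ dist (z.1 - z.2) ≤ C * ε} := by ring
      _ = _ := by rw [ENNReal.mul_inv_cancel hb hbt, one_mul, one_mul]

end StochasticTriangle

/-! ### Probability that a vertex lies in a triangle. -/

section Triangles

variable {d n : ℕ} {w : Fin n → ℝ} {p : Torus d → Torus d → ℝ → ℝ → ℝ} {dist : Torus d → ℝ}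

/-- The vertices `a` and `b` are `ε`-close to `v` and `s`-close to each other, at three distinct
positions. -/
def closeTriple (dist : Torus d → ℝ) (ε s : ℝ) (v a b : Fin n) : Set (Fin n → Torus d) :=
  {x | (dist (x a - x v) ≤ ε ∧ dist (x b - x v) ≤ ε ∧ dist (x a - x b) ≤ s) ∧
    x a ≠ x v ∧ x b ≠ x v ∧ x a ≠ x b}

/-- The coins of the three pairs are below `c`. -/
def smallCoins (c : ℝ) (v a b : Fin n) : Set (Fin n → Fin n → unitInterval) :=
  {U | ∀ e ∈ ({coin v a, coin v b, coin a b} : Finset (Fin n × Fin n)),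
    U e.1 e.2 ∈ {t : unitInterval | (t : ℝ) < c}}

lemma adj_of_close (h : IsDistanceFunction dist) {r c : ℝ}
    (hclose : ∀ u v : Fin n, ∀ x y, x ≠ y → dist (x - y) ≤ r → c ≤ p x y (w u) (w v))
    {ω : Sample d n} {u v : Fin n} (hne : ω.1 u ≠ ω.1 v) (hr : dist (ω.1 u - ω.1 v) ≤ r)
    (hc : (ω.2 (coin u v).1 (coin u v).2 : ℝ) < c) : (girg w p ω).Adj u v := by
  have huv : u ≠ v := fun e => hne (by rw [e])
  rw [girg_adj_iff huv]
  refine lt_of_lt_of_le hc (hclose _ _ _ _ ?_ ?_)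
  · rcases le_total u v with h1 | h1
    · rwa [min_eq_left h1, max_eq_right h1]
    · rw [min_eq_right h1, max_eq_left h1]; exact hne.symm
  · rcases le_total u v with h1 | h1
    · rwa [min_eq_left h1, max_eq_right h1]
    · rw [min_eq_right h1, max_eq_left h1, ← neg_sub, h.symm]; exact hr

lemma inTriangle_of_close (h : IsDistanceFunction dist) {ε s c : ℝ}
    (hε : ∀ u v : Fin n, ∀ x y, x ≠ y → dist (x - y) ≤ ε → c ≤ p x y (w u) (w v))
    (hs : ∀ u v : Fin n, ∀ x y, x ≠ y → dist (x - y) ≤ s → c ≤ p x y (w u) (w v))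
    {ω : Sample d n} {v a b : Fin n} (hω : ω ∈ closeTriple dist ε s v a b ×ˢ smallCoins c v a b) :
    InTriangle (girg w p ω) v := by
  obtain ⟨⟨⟨h1, h2, h3⟩, h4, h5, h6⟩, h7⟩ := hω
  have hc : ∀ e ∈ ({coin v a, coin v b, coin a b} : Finset (Fin n × Fin n)),
    (ω.2 e.1 e.2 : ℝ) < c := h7
  refine ⟨a, b, (adj_of_close h hε h4 h1 ?_).symm, (adj_of_close h hε h5 h2 ?_).symm,
    adj_of_close h hs h6 h3 (hc _ (by simp))⟩
  · rw [coin_comm]; exact hc _ (by simp)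
  · rw [coin_comm]; exact hc _ (by simp)

lemma measurable_dist_sub (h : IsDistanceFunction dist) (a v : Fin n) :
    Measurable fun x : Fin n → Torus d => dist (x a - x v) :=
  h.measurable.comp ((measurable_pi_apply a).sub (measurable_pi_apply v))

lemma measurableSet_closeTriple (h : IsDistanceFunction dist) (ε s : ℝ) (v a b : Fin n) :
    MeasurableSet (closeTriple dist ε s v a b) := by
  have hne : ∀ a b : Fin n, MeasurableSet {x : Fin n → Torus d | x a ≠ x b} := fun a b =>
    (measurableSet_eq_fun (measurable_pi_apply a) (measurable_pi_apply b)).compl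
  have hle : ∀ (a b : Fin n) (r : ℝ),
      MeasurableSet {x : Fin n → Torus d | dist (x a - x b) ≤ r} := fun a b r =>
    measurableSet_le (measurable_dist_sub h a b) measurable_const
  exact ((hle a v ε).inter ((hle b v ε).inter (hle a b s))).inter
    ((hne a v).inter ((hne b v).inter (hne a b)))

lemma measurableSet_smallCoins (c : ℝ) (v a b : Fin n) :
    MeasurableSet (smallCoins c v a b) := by
  have : smallCoins c v a b = ⋂ e ∈ ({coin v a, coin v b, coin a b} : Finset (Fin n × Fin n)),
      {U : Fin n → Fin n → unitInterval | (U e.1 e.2 : ℝ) < c} := by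
    ext U; simp [smallCoins]
  rw [this]
  refine Finset.measurableSet_biInter _ fun e _ => measurableSet_lt ?_ measurable_const
  exact measurable_subtype_coe.comp ((measurable_pi_apply e.2).comp (measurable_pi_apply e.1))

lemma volume_smallCoins {c : ℝ} (h0 : 0 ≤ c) (h1 : c ≤ 1) (v a b : Fin n) :
    ENNReal.ofReal (c ^ 3) ≤ volume (smallCoins c v a b) := by
  rw [smallCoins, volume_pi_pi_forall_mem, Finset.prod_const, ENNReal.ofReal_pow h0]
  refine le_trans ?_ (pow_le_pow_left' (le_volume_unitInterval_lt h0 h1) _)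
  -- Coinciding coins only raise the probability, so the vertices need not be distinct here.
  exact pow_le_pow_right_of_le_one' (by simpa using h1) Finset.card_le_three

lemma volume_eq_position (h : IsDistanceFunction dist) {a b : Fin n} (hab : a ≠ b) :
    volume {x : Fin n → Torus d | x a = x b} = 0 := by
  have := (measurePreserving_sub_apply (G := Torus d) hab).measure_preimage
    (measurableSet_singleton (0 : Torus d)).nullMeasurableSet
  rw [volume_singleton_zero h] at this
  rw [← this]
  congr 1
  ext x
  simp [sub_eq_zero]

lemma volume_closeTriple (h : IsDistanceFunction dist) (ε s : ℝ) {v a b : Fin n} (ha : a ≠ v)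
    (hb : b ≠ v) (hab : a ≠ b) :
    volume {z : Torus d × Torus d | dist z.1 ≤ ε ∧ dist z.2 ≤ ε ∧ dist (z.1 - z.2) ≤ s} ≤
      volume (closeTriple dist ε s v a b) := by
  have hm : MeasurableSet
      {z : Torus d × Torus d | dist z.1 ≤ ε ∧ dist z.2 ≤ ε ∧ dist (z.1 - z.2) ≤ s} :=
    (measurableSet_le (h.measurable.comp measurable_fst) measurable_const).inter
      ((measurableSet_le (h.measurable.comp measurable_snd) measurable_const).inter
      (measurableSet_le (h.measurable.comp (measurable_fst.sub measurable_snd)) measurable_const))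
  rw [← (measurePreserving_sub_apply₂ (G := Torus d) ha hb hab).measure_preimage
    hm.nullMeasurableSet]
  have hsub : (fun x : Fin n → Torus d => (x a - x v, x b - x v)) ⁻¹'
      {z : Torus d × Torus d | dist z.1 ≤ ε ∧ dist z.2 ≤ ε ∧ dist (z.1 - z.2) ≤ s} ⊆
      closeTriple dist ε s v a b ∪ ({x | x a = x v} ∪ ({x | x b = x v} ∪ {x | x a = x b})) := by
    intro x hx
    simp only [mem_preimage, mem_ofPred_eq, sub_sub_sub_cancel_right] at hx
    simp only [mem_union, mem_ofPred_eq, closeTriple]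
    tauto
  refine (measure_mono hsub).trans ((measure_union_le _ _).trans ?_)
  rw [measure_union_null (volume_eq_position h ha)
    (measure_union_null (volume_eq_position h hb) (volume_eq_position h hab)), add_zero]

lemma volume_near_three (h : IsDistanceFunction dist) (ε : ℝ) {v a b z : Fin n} (ha : a ≠ v)
    (hb : b ≠ v) (hz : z ≠ v) (hab : a ≠ b) (haz : a ≠ z) (hbz : b ≠ z) :
    volume {x : Fin n → Torus d |
      dist (x a - x v) ≤ ε ∧ dist (x b - x v) ≤ ε ∧ dist (x z - x v) ≤ ε} =
      ENNReal.ofReal (ballVol dist ε ^ 3) := by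
  have hm : MeasurableSet (ball dist ε) := measurableSet_le h.measurable measurable_const
  have := (measurePreserving_sub_apply₃ (G := Torus d) ha hb hz hab haz hbz).measure_preimage
    (hm.prod (hm.prod hm)).nullMeasurableSet
  rw [Measure.volume_eq_prod, Measure.volume_eq_prod, Measure.prod_prod, Measure.prod_prod,
    volume_ball, ← ENNReal.ofReal_mul (ballVol_nonneg _),
    ← ENNReal.ofReal_mul (ballVol_nonneg _)] at this
  rw [show ballVol dist ε ^ 3 = ballVol dist ε * (ballVol dist ε * ballVol dist ε) by ring, ← this]
  rfl

/-- The probability that a vertex is in a triangle: close triples without a further vertex close to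
`v` are disjoint events. -/
lemma le_measureReal_inTriangle (h : IsDistanceFunction dist) {ε s c q : ℝ} (hc0 : 0 ≤ c)
    (hc1 : c ≤ 1) (hq : 0 ≤ q)
    (hε : ∀ u v : Fin n, ∀ x y, x ≠ y → dist (x - y) ≤ ε → c ≤ p x y (w u) (w v))
    (hs : ∀ u v : Fin n, ∀ x y, x ≠ y → dist (x - y) ≤ s → c ≤ p x y (w u) (w v))
    (htri : ENNReal.ofReal (q * ballVol dist ε ^ 2) ≤ volume {z : Torus d × Torus d |
        dist z.1 ≤ ε ∧ dist z.2 ≤ ε ∧ dist (z.1 - z.2) ≤ s})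
    (v : Fin n) {A B : Finset (Fin n)} (hA : v ∉ A) (hB : v ∉ B) (hAB : Disjoint A B) :
    (A.card * B.card : ℝ) * (c ^ 3 * q * ballVol dist ε ^ 2 - n * ballVol dist ε ^ 3) ≤
      (volume : Measure (Sample d n)).real {ω | InTriangle (girg w p ω) v} := by
  set near : Fin n → Fin n → Fin n → Set (Sample d n) := fun a b z =>
    {x : Fin n → Torus d | dist (x a - x v) ≤ ε ∧ dist (x b - x v) ≤ ε ∧ dist (x z - x v) ≤ ε} ×ˢ
      univ with hnear
  set T : Fin n → Fin n → Set (Sample d n) := fun a b =>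
    closeTriple dist ε s v a b ×ˢ smallCoins c v a b with hT
  set O : Fin n → Fin n → Finset (Fin n) := fun a b =>
    Finset.univ.filter fun z => z ≠ v ∧ a ≠ z ∧ b ≠ z with hO
  set D : Fin n × Fin n → Set (Sample d n) := fun e =>
    T e.1 e.2 \ ⋃ z ∈ O e.1 e.2, near e.1 e.2 z with hD
  have hle : ∀ (a : Fin n), MeasurableSet {x : Fin n → Torus d | dist (x a - x v) ≤ ε} :=
    fun a => measurableSet_le (measurable_dist_sub h a v) measurable_const
  have hTm : ∀ a b, MeasurableSet (T a b) := fun a b =>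
    (measurableSet_closeTriple h ε s v a b).prod (measurableSet_smallCoins c v a b)
  have hnm : ∀ a b z, MeasurableSet (near a b z) := fun a b z =>
    ((hle a).inter ((hle b).inter (hle z))).prod MeasurableSet.univ
  have hDm : ∀ e, MeasurableSet (D e) := fun e =>
    (hTm _ _).diff (Finset.measurableSet_biUnion _ fun z _ => hnm _ _ z)
  have hTv : ∀ a b, a ≠ v → b ≠ v → a ≠ b →
      c ^ 3 * q * ballVol dist ε ^ 2 ≤ (volume : Measure (Sample d n)).real (T a b) := by
    intro a b ha hb hab
    refine (ENNReal.ofReal_le_iff_le_toReal (measure_ne_top _ _)).1 ?_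
    rw [hT, Measure.volume_eq_prod, Measure.prod_prod,
      show c ^ 3 * q * ballVol dist ε ^ 2 = (q * ballVol dist ε ^ 2) * c ^ 3 by ring,
      ENNReal.ofReal_mul (by positivity)]
    exact mul_le_mul' (htri.trans (volume_closeTriple h ε s ha hb hab))
      (volume_smallCoins hc0 hc1 v a b)
  -- Union bound over the at most `n` candidates for a further vertex close to `v`.
  have hnv : ∀ a b, a ≠ v → b ≠ v → a ≠ b →
      (volume : Measure (Sample d n)).real (⋃ z ∈ O a b, near a b z) ≤
        n * ballVol dist ε ^ 3 := by
    intro a b ha hb hab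
    refine (measureReal_biUnion_finset_le _ _).trans ?_
    have h1 : ∀ z ∈ O a b, (volume : Measure (Sample d n)).real (near a b z) ≤
        ballVol dist ε ^ 3 := by
      intro z hz
      simp only [hO, Finset.mem_filter, Finset.mem_univ, true_and] at hz
      refine ENNReal.toReal_le_of_le_ofReal (pow_nonneg (ballVol_nonneg _) _) ?_
      rw [hnear, Measure.volume_eq_prod, Measure.prod_prod,
        volume_near_three h ε ha hb hz.1 hab hz.2.1 hz.2.2, measure_univ, mul_one]
    refine (Finset.sum_le_sum h1).trans ?_
    rw [Finset.sum_const, nsmul_eq_mul]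
    have h2 : (O a b).card ≤ n := by simpa using Finset.card_le_univ (O a b)
    have h3 : ((O a b).card : ℝ) ≤ n := by exact_mod_cast h2
    exact mul_le_mul_of_nonneg_right h3 (pow_nonneg (ballVol_nonneg _) _)
  have hprop : ∀ e ∈ A ×ˢ B, e.1 ≠ v ∧ e.2 ≠ v ∧ e.1 ≠ e.2 := by
    intro e he
    rw [Finset.mem_product] at he
    exact ⟨fun e' => hA (e' ▸ he.1), fun e' => hB (e' ▸ he.2),
      fun e' => Finset.disjoint_left.1 hAB he.1 (e' ▸ he.2)⟩
  -- Because `A` and `B` are disjoint, two different pairs are never the same pair in reverse order.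
  -- The second pair thus has a member outside the first, and `D` forbids that member from being
  -- close to `v`.
  have hdisj : Set.PairwiseDisjoint (↑(A ×ˢ B)) D := by
    have aux : ∀ e ∈ A ×ˢ B, ∀ z, z ≠ v → e.1 ≠ z → e.2 ≠ z → ∀ ω ∈ D e,
        ¬ dist (ω.1 z - ω.1 v) ≤ ε := by
      intro e he z hz h1 h2 ω hω hdist
      refine hω.2 (mem_biUnion (show z ∈ O e.1 e.2 from ?_) ?_)
      · simp [hO, hz, h1, h2]
      · exact ⟨⟨hω.1.1.1.1, hω.1.1.1.2.1, hdist⟩, mem_univ _⟩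
    intro e he e' he' hne
    have he2 := Finset.mem_product.1 he
    have he2' := Finset.mem_product.1 he'
    refine Set.disjoint_left.2 fun ω hω hω' => ?_
    by_cases h1 : e.1 = e'.1
    · have h2 : e.2 ≠ e'.2 := fun h2 => hne (Prod.ext h1 h2)
      exact aux e he e'.2 (hprop e' he').2.1
        (fun e3 => Finset.disjoint_left.1 hAB he2.1 (e3 ▸ he2'.2)) h2 ω hω hω'.1.1.1.2.1
    · exact aux e he e'.1 (hprop e' he').1 h1
        (fun e3 => Finset.disjoint_left.1 hAB he2'.1 (e3 ▸ he2.2)) ω hω hω'.1.1.1.1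
  calc (A.card * B.card : ℝ) * (c ^ 3 * q * ballVol dist ε ^ 2 - n * ballVol dist ε ^ 3)
      = ∑ _e ∈ A ×ˢ B, (c ^ 3 * q * ballVol dist ε ^ 2 - n * ballVol dist ε ^ 3) := by
        rw [Finset.sum_const, Finset.card_product, nsmul_eq_mul, Nat.cast_mul]
    _ ≤ ∑ e ∈ A ×ˢ B, (volume : Measure (Sample d n)).real (D e) := by
        refine Finset.sum_le_sum fun e he => ?_
        obtain ⟨h1, h2, h3⟩ := hprop e he
        refine le_trans ?_ (le_measureReal_sdiff (h := measure_ne_top _ _))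
        exact sub_le_sub (hTv _ _ h1 h2 h3) (hnv _ _ h1 h2 h3)
    _ = (volume : Measure (Sample d n)).real (⋃ e ∈ A ×ˢ B, D e) :=
        (measureReal_biUnion_finset hdisj fun e _ => hDm e).symm
    _ ≤ _ := by
        refine measureReal_mono (iUnion₂_subset fun e _ ω hω => ?_)
        exact inTriangle_of_close h hε hs hω.1

lemma exists_disjoint_finsets (v : Fin n) : ∃ A B : Finset (Fin n), v ∉ A ∧ v ∉ B ∧ Disjoint A B ∧
    n ≤ 2 * A.card + 2 ∧ n ≤ 2 * B.card + 2 := by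
  classical
  have hc : (Finset.univ.erase v).card = n - 1 := by simp
  obtain ⟨A, hA, hAc⟩ := Finset.exists_subset_card_eq (s := Finset.univ.erase v)
    (n := (n - 1) / 2) (by omega)
  refine ⟨A, Finset.univ.erase v \ A, fun h => Finset.notMem_erase _ _ (hA h), by simp,
    Finset.disjoint_sdiff, by omega, ?_⟩
  rw [Finset.card_sdiff_of_subset hA]
  omega

end Triangles

/-! ### Expectation, concentration and the clustering theorem. -/

section Main

variable {d n : ℕ} {α : ℝ} {w : Fin n → ℝ} {p : Torus d → Torus d → ℝ → ℝ → ℝ}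
  {dist : Torus d → ℝ} {c : ℝ}

lemma dominatedAt_kernel (h : IsDistanceFunction dist) (hw : ∀ v, 0 < w v)
    (hU : ∀ x y, ∀ a > 0, ∀ b > 0,
      p x y a b ≤ c * kernel α n (a * b) (ballVol dist (dist (x - y)))) (k : Fin n) :
    DominatedAt w p k fun u x => c * kernel α n (w k * w u) (ballVol dist (dist x)) := by
  intro ω u hu hadj
  rw [girg_adj_iff hu.symm] at hadj
  refine hadj.trans_le ((hU _ _ _ (hw _) _ (hw _)).trans (le_of_eq ?_))
  dsimp only
  rcases le_total k u with h1 | h1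
  · rw [min_eq_left h1, max_eq_right h1, ← h.symm (ω.1 u - ω.1 k), neg_sub]
  · rw [min_eq_right h1, max_eq_left h1, mul_comm (w u)]

lemma lintegral_mul_kernel_le (h : IsDistanceFunction dist) (hα : 1 < α) (hn : 0 < n)
    (hc : 0 ≤ c) {a : ℝ} (ha : 0 < a) :
    ∫⁻ x, ENNReal.ofReal (c * kernel α n a (ballVol dist (dist x))) ≤
      ENNReal.ofReal (c * kernelConst α * (a / n)) := by
  simp_rw [ENNReal.ofReal_mul hc]
  rw [lintegral_const_mul _ (measurable_kernel_comp h n a).ennreal_ofReal, mul_assoc,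
    ENNReal.ofReal_mul hc]
  exact mul_le_mul_right (lintegral_kernel_le h hα hn ha) _

/-- First and second moments of the degrees. -/
lemma degree_moments_le (h : IsDistanceFunction dist) (hα : 1 < α) (hn : 0 < n)
    (hw : ∀ v, 0 < w v) {W : ℝ} (hW : ∑ v, w v ≤ W * n)
    (hp : ∀ a > 0, ∀ b > 0, Measurable fun z : Torus d × Torus d => p z.1 z.2 a b) (hc : 0 ≤ c)
    (hU : ∀ x y, ∀ a > 0, ∀ b > 0,
      p x y a b ≤ c * kernel α n (a * b) (ballVol dist (dist (x - y)))) (k : Fin n) :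
    ∫ ω : Sample d n, (((girg w p ω).neighborSet k).ncard : ℝ) ≤ c * kernelConst α * W * w k ∧
    ∫ ω : Sample d n, (((girg w p ω).neighborSet k).ncard : ℝ) ^ 2 ≤
      c * kernelConst α * W * w k + (c * kernelConst α * W * w k) ^ 2 := by
  have hn' : (0 : ℝ) < n := by exact_mod_cast hn
  have hκ := kernelConst_pos hα
  have H := dominatedAt_kernel h hw hU k
  have hm : ∀ u : Fin n, Measurable fun x =>
      c * kernel α n (w k * w u) (ballVol dist (dist x)) := fun u =>
    measurable_const.mul (measurable_kernel_comp h n _)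
  have hq0 : ∀ u, 0 ≤ c * kernelConst α * (w k * w u / n) := fun u =>
    mul_nonneg (mul_nonneg hc hκ.le) (div_nonneg (mul_pos (hw k) (hw u)).le hn'.le)
  have hq : ∀ u, ∫⁻ x, ENNReal.ofReal (c * kernel α n (w k * w u) (ballVol dist (dist x))) ≤
      ENNReal.ofReal (c * kernelConst α * (w k * w u / n)) := fun u =>
    lintegral_mul_kernel_le h hα hn hc (mul_pos (hw k) (hw u))
  have hsum : ∑ u, c * kernelConst α * (w k * w u / n) ≤ c * kernelConst α * W * w k := by
    rw [← Finset.mul_sum, ← Finset.sum_div, ← Finset.mul_sum, mul_assoc (c * kernelConst α)]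
    refine mul_le_mul_of_nonneg_left ?_ (mul_nonneg hc hκ.le)
    rw [div_le_iff₀ hn']
    have := mul_le_mul_of_nonneg_left hW (hw k).le
    linarith
  have hsum0 : 0 ≤ ∑ u, c * kernelConst α * (w k * w u / n) := Finset.sum_nonneg fun u _ => hq0 u
  refine ⟨(integral_degree_le hw hp H hm hq0 hq).trans hsum,
    (integral_degree_sq_le hw hp H hm hq0 hq).trans ?_⟩
  exact add_le_add hsum (pow_le_pow_left₀ hsum0 hsum 2)

/-- If every vertex is in a triangle with probability at least `c₀` and the degrees have
expectations `D w v`, then the expected clustering coefficient is bounded away from zero. -/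
lemma le_integral_sum_ccVertex (hw : ∀ v, 0 < w v)
    (hp : ∀ a > 0, ∀ b > 0, Measurable fun z : Torus d × Torus d => p z.1 z.2 a b)
    {c₀ D W : ℝ} (hc₀ : 0 < c₀) (hD : 0 < D) (hW0 : 0 < W) (hW : ∑ v, w v ≤ W * n)
    (htri : ∀ v, c₀ ≤ (volume : Measure (Sample d n)).real {ω | InTriangle (girg w p ω) v})
    (hdeg : ∀ v, ∫ ω : Sample d n, (((girg w p ω).neighborSet v).ncard : ℝ) ≤ D * w v) :
    1 / (2 * D * W / c₀) ^ 2 * (c₀ / 2) * n ≤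
      ∫ ω : Sample d n, ∑ v, ccVertex (girg w p ω) v := by
  classical
  -- With this cutoff the total degree correction `D * W * n / K` is exactly half of `c₀ * n`.
  set K : ℝ := 2 * D * W / c₀ with hK
  have hK0 : 0 < K := by positivity
  have h1 : ∀ v, 1 / K ^ 2 * (c₀ - D * w v / K) ≤ ∫ ω : Sample d n, ccVertex (girg w p ω) v := by
    intro v
    have i1 : Integrable fun ω : Sample d n => if InTriangle (girg w p ω) v then (1 : ℝ) else 0 :=
      integrable_comp_girg hw hp fun G => if InTriangle G v then (1 : ℝ) else 0
    have i2 : Integrable fun ω : Sample d n => (((girg w p ω).neighborSet v).ncard : ℝ) / K :=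
      integrable_comp_girg hw hp fun G => ((G.neighborSet v).ncard : ℝ) / K
    have hm : MeasurableSet {ω : Sample d n | InTriangle (girg w p ω) v} :=
      measurableSet_setOfPred.2 (measurable_comp_girg hw hp fun G => InTriangle G v)
    calc 1 / K ^ 2 * (c₀ - D * w v / K)
        ≤ 1 / K ^ 2 * ((volume : Measure (Sample d n)).real {ω | InTriangle (girg w p ω) v} -
          (∫ ω : Sample d n, (((girg w p ω).neighborSet v).ncard : ℝ)) / K) := by
          gcongr
          · exact htri v
          · exact hdeg v
      _ = ∫ ω : Sample d n, 1 / K ^ 2 * ((if InTriangle (girg w p ω) v then (1 : ℝ) else 0) -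
          (((girg w p ω).neighborSet v).ncard : ℝ) / K) := by
          rw [integral_const_mul, integral_sub i1 i2, integral_div,
            integral_ite_eq_measureReal hm]
      _ ≤ _ := by
          refine integral_mono ((i1.sub i2).const_mul _)
            (integrable_comp_girg hw hp fun G => ccVertex G v) fun ω => ?_
          exact indicator_triangle_sub_le_ccVertex _ v hK0
  rw [integral_finsetSum _ fun v _ => integrable_comp_girg hw hp fun G => ccVertex G v]
  refine le_trans ?_ (Finset.sum_le_sum fun v _ => h1 v)
  rw [← Finset.mul_sum, Finset.sum_sub_distrib, ← Finset.sum_div, ← Finset.mul_sum, mul_assoc]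
  refine mul_le_mul_of_nonneg_left ?_ (by positivity)
  have h2 : D * (∑ v, w v) / K ≤ D * (W * n) / K := by gcongr
  have h3 : D * (W * n) / K = c₀ / 2 * n := by
    rw [hK]; field_simp
  simp only [Finset.sum_const, Finset.card_univ, Fintype.card_fin, nsmul_eq_mul]
  linarith

/-- For radii `ε` with `V(ε) = δ / n`, every vertex lies in a triangle with probability bounded
away from zero. -/
lemma exists_le_measureReal_inTriangle (h : IsDistanceFunction dist) (hα : 1 < α)
    (hs : StochasticTriangleInequality dist) {m : ℝ} (hm : 0 < m) (hc0 : 0 < c) (hc1 : c ≤ 1) :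
    ∃ c₀ > 0, ∀ᶠ n : ℕ in atTop, ∀ (w : Fin n → ℝ) (p : Torus d → Torus d → ℝ → ℝ → ℝ),
      (∀ v, m ≤ w v) → (∀ x y, x ≠ y → ∀ a > 0, ∀ b > 0,
        c * kernel α n (a * b) (ballVol dist (dist (x - y))) ≤ p x y a b) →
      ∀ v, c₀ ≤ (volume : Measure (Sample d n)).real {ω | InTriangle (girg w p ω) v} := by
  obtain ⟨C, hC, q, hq0, hq1, hev⟩ := hs.exists_const h
  -- The first bound gives `n * V(C * ε) ≤ δ / q ≤ m ^ 2`, so the kernel is saturated on all three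
  -- pairs. The second makes the loss `n * V(ε) ^ 3 = δ * V(ε) ^ 2` at most half of the main term `c
  -- ^ 3 * q * V(ε) ^ 2`.
  set δ : ℝ := min (q * m ^ 2) (c ^ 3 * q / 2) with hδ
  have hδ0 : 0 < δ := lt_min (by positivity) (by positivity)
  have hδ1 : δ ≤ q * m ^ 2 := min_le_left _ _
  have hδ2 : δ ≤ c ^ 3 * q / 2 := min_le_right _ _
  have hδ3 : δ ≤ 1 := by
    have : c ^ 3 ≤ 1 := pow_le_one₀ hc0.le hc1
    have : c ^ 3 * q ≤ 1 := mul_le_one₀ this hq0.le hq1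
    linarith
  obtain ⟨ε₀, hε₀, hε₀'⟩ := mem_nhdsGT_iff_exists_Ioo_subset.1 hev
  have hε₀0 : (0 : ℝ) < ε₀ := hε₀
  -- Positive volume strictly inside the good range: once `δ / n` drops below it, any radius of
  -- volume `δ / n` is smaller than `ε₀`.
  have hV0 : 0 < ballVol dist (ε₀ / 2) := (hε₀' ⟨by linarith, by linarith⟩).1
  refine ⟨1 / 36 * (δ ^ 2 * (c ^ 3 * q / 2)), by positivity, ?_⟩
  have hlim : ∀ᶠ n : ℕ in atTop, δ / n < ballVol dist (ε₀ / 2) :=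
    (tendsto_const_div_atTop_nhds_zero_nat δ).eventually_lt_const hV0
  filter_upwards [hlim, eventually_ge_atTop 3] with n hn1 hn3 w p hwm hL v
  have hn' : (3 : ℝ) ≤ n := by exact_mod_cast hn3
  have hn0 : (0 : ℝ) < n := by linarith
  obtain ⟨ε, hε, hVε⟩ := h.surj (show δ / n ∈ Icc (0 : ℝ) 1 from
    ⟨by positivity, (div_le_one hn0).2 (by linarith)⟩)
  have hεpos : 0 < ε := by
    refine lt_of_le_of_ne hε fun e => ?_
    rw [← e, ballVol_zero h] at hVε
    have : 0 < δ / n := by positivity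
    linarith
  have hεlt : ε < ε₀ := by
    by_contra hcon
    have := ballVol_mono (dist := dist) (show ε₀ / 2 ≤ ε by linarith [not_lt.1 hcon])
    linarith
  obtain ⟨-, hCV, htri⟩ := hε₀' ⟨hεpos, hεlt⟩
  have hclose : ∀ r, n * ballVol dist r ≤ m ^ 2 → ∀ u v : Fin n, ∀ x y, x ≠ y →
      dist (x - y) ≤ r → c ≤ p x y (w u) (w v) := by
    intro r hr u v x y hxy hxr
    have hu := hm.trans_le (hwm u)
    have hv := hm.trans_le (hwm v)
    have := hL x y hxy (w u) hu (w v) hv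
    rwa [kernel_eq_one (by linarith) (ballVol_nonneg _) (by omega), mul_one] at this
    calc n * ballVol dist (dist (x - y)) ≤ n * ballVol dist r :=
          mul_le_mul_of_nonneg_left (ballVol_mono hxr) hn0.le
      _ ≤ m ^ 2 := hr
      _ = m * m := sq m
      _ ≤ w u * w v := mul_le_mul (hwm u) (hwm v) hm.le hu.le
  have hnV : n * ballVol dist ε = δ := by rw [hVε]; field_simp
  have hr1 : n * ballVol dist ε ≤ m ^ 2 := by
    rw [hnV]
    exact hδ1.trans (mul_le_of_le_one_left (by positivity) hq1)
  have hr2 : n * ballVol dist (C * ε) ≤ m ^ 2 := by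
    have h1 := mul_le_mul_of_nonneg_left hCV hn0.le
    rw [hnV] at h1
    have h2 : q * (n * ballVol dist (C * ε)) ≤ q * m ^ 2 := by linarith
    exact le_of_mul_le_mul_left h2 hq0
  obtain ⟨A, B, hA, hB, hAB, hAc, hBc⟩ := exists_disjoint_finsets v
  refine le_trans ?_ (le_measureReal_inTriangle h hc0.le hc1 hq0.le (hclose ε hr1)
    (hclose (C * ε) hr2) htri v hA hB hAB)
  -- For `n ≥ 3`, `n / 2 - 1 ≥ n / 6`.
  have hA' : (n : ℝ) / 6 ≤ A.card := by
    have : (n : ℝ) ≤ 2 * A.card + 2 := by exact_mod_cast hAc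
    linarith
  have hB' : (n : ℝ) / 6 ≤ B.card := by
    have : (n : ℝ) ≤ 2 * B.card + 2 := by exact_mod_cast hBc
    linarith
  have e1 : c ^ 3 * q * ballVol dist ε ^ 2 - n * ballVol dist ε ^ 3 =
      (δ / n) ^ 2 * (c ^ 3 * q - δ) := by
    rw [← hVε, ← hnV]; ring
  rw [e1]
  calc 1 / 36 * (δ ^ 2 * (c ^ 3 * q / 2)) =
        ((n : ℝ) / 6 * (n / 6)) * ((δ / n) ^ 2 * (c ^ 3 * q / 2)) := by field_simp; norm_num
    _ ≤ (A.card * B.card : ℝ) * ((δ / n) ^ 2 * (c ^ 3 * q - δ)) := by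
        gcongr
        linarith

/-- Clustering for distance functions with the stochastic triangle inequality. -/
theorem clusteringWhp_ballVol {β : ℝ} (hα : 1 < α) (hβ : 2 < β)
    {w : ∀ n : ℕ, Fin n → ℝ} (hw : IsPowerLawWeights β w)
    {p : ℕ → Torus d → Torus d → ℝ → ℝ → ℝ} (h : IsDistanceFunction dist)
    (hs : StochasticTriangleInequality dist)
    (hp : IsEdgeProbability α dist (ballVol dist) p) : ClusteringWhp w p := by
  obtain ⟨m, hm, W, hW0, hwm, hW, hsq⟩ := hw.exists_bounds hβ
  obtain ⟨cL, hcL, cU, hcU, hθ⟩ := hp.theta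
  obtain ⟨c₀, hc₀, htri⟩ := exists_le_measureReal_inTriangle h hα hs hm
    (show 0 < min cL 1 from lt_min hcL one_pos) (min_le_right _ _)
  have hκ := kernelConst_pos hα
  -- The kernel bounds are assumed only for `x ≠ y`. On the diagonal the kernel is `1`, so a
  -- constant of at least `1` makes the upper bound valid everywhere.
  have hcU1 : 0 < max cU 1 := lt_max_of_lt_right one_pos
  set D : ℝ := max cU 1 * kernelConst α * W with hD
  have hD0 : 0 < D := by positivity
  set c₁ : ℝ := 1 / (2 * D * W / c₀) ^ 2 * (c₀ / 2) with hc₁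
  have hc₁0 : 0 < c₁ := by positivity
  refine ⟨c₁ / 2, by positivity, ?_⟩
  -- Chebyshev's bound for a deviation of `c₁ / 2 * n`, half of the lower bound on the mean.
  set b : ℕ → ℝ := fun n =>
    4 / c₁ ^ 2 * ((3 / 2 + 3 * (D * W)) / n + 3 * D ^ 2 * ((∑ v, w n v ^ 2) / (n : ℝ) ^ 2)) with hb
  have hblim : Tendsto b atTop (𝓝 0) := by
    have := ((tendsto_const_div_atTop_nhds_zero_nat (3 / 2 + 3 * (D * W))).add
      (hsq.const_mul (3 * D ^ 2))).const_mul (4 / c₁ ^ 2)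
    simpa using this
  have hlow : Tendsto (fun n => 1 - ENNReal.ofReal (b n)) atTop (𝓝 1) := by
    have h1 := (ENNReal.continuous_ofReal.tendsto 0).comp hblim
    have h2 := ENNReal.Tendsto.sub (tendsto_const_nhds (x := (1 : ENNReal)) (f := atTop)) h1
      (Or.inl ENNReal.one_ne_top)
    simpa using h2
  refine tendsto_of_tendsto_of_tendsto_of_le_of_le' hlow tendsto_const_nhds ?_
    (Eventually.of_forall fun n => prob_le_one)
  filter_upwards [hwm, hW, htri, hθ, eventually_gt_atTop 0] with n hwm hW htri hθ hn
  have hn' : (0 : ℝ) < n := by exact_mod_cast hn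
  have hwpos := hw.pos n
  have hpm := hp.measurable n
  have hU : ∀ x y, ∀ a > 0, ∀ b > 0, p n x y a b ≤
      max cU 1 * kernel α n (a * b) (ballVol dist (dist (x - y))) := by
    intro x y a ha b hb
    have hk := kernel_nonneg (α := α) (n := n) (mul_pos ha hb).le
      (ballVol_nonneg (dist := dist) (dist (x - y)))
    by_cases hxy : x = y
    · subst hxy
      have : kernel α n (a * b) (ballVol dist (dist (x - x))) = 1 := by
        rw [sub_self, h.zero, ballVol_zero h, kernel, if_pos rfl]
      rw [this, mul_one]
      exact (hp.mem_Icc n x x a ha b hb).2.trans (le_max_right _ _)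
    · exact (hθ x y hxy a ha b hb).2.trans (mul_le_mul_of_nonneg_right (le_max_left _ _) hk)
  have hL : ∀ x y, x ≠ y → ∀ a > 0, ∀ b > 0,
      min cL 1 * kernel α n (a * b) (ballVol dist (dist (x - y))) ≤ p n x y a b := by
    intro x y hxy a ha b hb
    have hk := kernel_nonneg (α := α) (n := n) (mul_pos ha hb).le
      (ballVol_nonneg (dist := dist) (dist (x - y)))
    exact (mul_le_mul_of_nonneg_right (min_le_left _ _) hk).trans (hθ x y hxy a ha b hb).1
  have hdeg := degree_moments_le h hα hn hwpos hW hpm hcU1.le hU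
  have hmean := le_integral_sum_ccVertex hwpos hpm hc₀ hD0 hW0 hW (htri (w n) (p n) hwm hL)
    fun v => (hdeg v).1
  set F : Sample d n → ℝ := fun ω => ∑ v, ccVertex (girg (w n) (p n) ω) v with hF
  rw [← hc₁] at hmean
  have hFm : Measurable F := measurable_comp_girg hwpos hpm fun G => ∑ v, ccVertex G v
  have hFB : ∀ ω, |F ω| ≤ n := by
    intro ω
    rw [abs_of_nonneg (Finset.sum_nonneg fun v _ => ccVertex_nonneg _ v)]
    refine (Finset.sum_le_sum fun v _ => ccVertex_le_one _ v).trans ?_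
    simp
  have hFL : MemLp F 2 volume :=
    MemLp.of_bound hFm.aestronglyMeasurable n (Eventually.of_forall hFB)
  have hvar : ProbabilityTheory.variance F volume ≤
      (3 / 2 + 3 * (D * W)) * n + 3 * D ^ 2 * ∑ v, w n v ^ 2 := by
    refine (variance_sum_ccVertex_le hwpos hpm).trans ?_
    calc _ ≤ 3 / 2 * ∑ k, (1 + 2 * (D * w n k + (D * w n k) ^ 2)) := by
          gcongr with k _
          exact (hdeg k).2
      _ = 3 / 2 * n + 3 * D * ∑ k, w n k + 3 * D ^ 2 * ∑ k, w n k ^ 2 := by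
          simp_rw [mul_pow, mul_add, Finset.sum_add_distrib, ← Finset.mul_sum]
          simp
          ring
      _ ≤ _ := by
          have := mul_le_mul_of_nonneg_left hW (show 0 ≤ 3 * D by positivity)
          linarith
  have hcheb := ProbabilityTheory.meas_ge_le_variance_div_sq hFL
    (show 0 < c₁ / 2 * n by positivity)
  have hbn : ProbabilityTheory.variance F volume / (c₁ / 2 * n) ^ 2 ≤ b n := by
    rw [div_le_iff₀ (by positivity)]
    refine hvar.trans (le_of_eq ?_)
    simp only [hb]
    field_simp
    norm_num
  rw [tsub_le_iff_right]
  calc (1 : ENNReal) = volume (univ : Set (Sample d n)) := measure_univ.symm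
    _ ≤ volume ({ω : Sample d n | c₁ / 2 ≤ cc (girg (w n) (p n) ω)} ∪
          {ω | c₁ / 2 * n ≤ |F ω - ∫ ω, F ω|}) := by
        refine measure_mono fun ω _ => ?_
        by_contra hcon
        simp only [mem_union, mem_ofPred_eq, not_or, not_le, cc, Fintype.card_fin] at hcon
        have h1 : F ω < c₁ / 2 * n := by
          have := hcon.1
          rw [one_div, inv_mul_lt_iff₀ hn'] at this
          linarith
        have h2 := (abs_lt.1 hcon.2).1
        linarith
    _ ≤ _ := (measure_union_le _ _).trans
        (add_le_add le_rfl (hcheb.trans (ENNReal.ofReal_le_ofReal hbn)))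

end Main

/-! ### The minimum component distance. -/

section MinimumComponent

variable {d : ℕ}

lemma mcd_le_iff (hd : 1 ≤ d) {x : Torus d} {r : ℝ} : mcd d x ≤ r ↔ ∃ i, ‖x i‖ ≤ r := by
  have : Nonempty (Fin d) := ⟨⟨0, hd⟩⟩
  constructor
  · intro h
    obtain ⟨i, hi⟩ := exists_eq_ciInf_of_finite (f := fun i => ‖x i‖)
    exact ⟨i, hi.trans_le h⟩
  · rintro ⟨i, hi⟩
    exact (ciInf_le (Set.finite_range fun i => ‖x i‖).bddBelow i).trans hi

lemma measurable_mcd : Measurable (mcd d) :=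
  Measurable.iInf fun i => (measurable_pi_apply i).norm

lemma mcd_nonneg (x : Torus d) : 0 ≤ mcd d x := Real.iInf_nonneg fun _ => norm_nonneg _

lemma mcd_le_half (hd : 1 ≤ d) (x : Torus d) : mcd d x ≤ 1 / 2 :=
  (mcd_le_iff hd).2 ⟨⟨0, hd⟩, by simpa using AddCircle.norm_le_half_period 1 one_ne_zero⟩

lemma volume_norm_le {r : ℝ} (hr : r ≤ 1 / 2) :
    volume {y : UnitAddCircle | ‖y‖ ≤ r} = ENNReal.ofReal (2 * r) := by
  have := AddCircle.volume_closedBall 1 (x := (0 : UnitAddCircle)) r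
  rw [min_eq_right (by linarith)] at this
  rw [← this]
  congr 1
  ext y
  simp

lemma measurableSet_norm_le (r : ℝ) : MeasurableSet {y : UnitAddCircle | ‖y‖ ≤ r} :=
  measurableSet_le measurable_norm measurable_const

lemma volume_component_le (i : Fin d) {r : ℝ} (hr : r ≤ 1 / 2) :
    volume {x : Torus d | ‖x i‖ ≤ r} = ENNReal.ofReal (2 * r) := by
  rw [← volume_norm_le hr]
  exact (measurePreserving_eval (fun _ : Fin d => (volume : Measure UnitAddCircle)) i).measure_preimage
    (measurableSet_norm_le r).nullMeasurableSet

/-- The complement of the ball is a product: every component must exceed `r`. -/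
lemma ballVol_mcd (hd : 1 ≤ d) {r : ℝ} (h0 : 0 ≤ r) (hr : r ≤ 1 / 2) :
    ballVol (mcd d) r = 1 - (1 - 2 * r) ^ d := by
  have hc : (ball (mcd d) r)ᶜ = univ.pi fun _ => {y : UnitAddCircle | ‖y‖ ≤ r}ᶜ := by
    ext x
    simp [ball, mcd_le_iff hd, -not_le]
  have hm : MeasurableSet (ball (mcd d) r) := measurableSet_le measurable_mcd measurable_const
  have h1 : (volume : Measure (Torus d)).real (ball (mcd d) r)ᶜ = (1 - 2 * r) ^ d := by
    have e : volume {y : UnitAddCircle | ‖y‖ ≤ r}ᶜ = ENNReal.ofReal (1 - 2 * r) := by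
      rw [prob_compl_eq_one_sub (measurableSet_norm_le r), volume_norm_le hr,
        ENNReal.ofReal_sub _ (by linarith), ENNReal.ofReal_one]
    rw [hc, measureReal_def, volume_pi_pi]
    simp only [e, Finset.prod_const, Finset.card_univ, Fintype.card_fin]
    rw [ENNReal.toReal_pow, ENNReal.toReal_ofReal (by linarith)]
  rw [probReal_compl_eq_one_sub hm] at h1
  change (volume : Measure (Torus d)).real (ball (mcd d) r) = _
  linarith

lemma two_mul_le_ballVol_mcd (hd : 1 ≤ d) {r : ℝ} (h0 : 0 ≤ r) (hr : r ≤ 1 / 2) :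
    2 * r ≤ ballVol (mcd d) r := by
  rw [ballVol_mcd hd h0 hr]
  have := pow_le_of_le_one (show 0 ≤ 1 - 2 * r by linarith) (by linarith)
    (show d ≠ 0 by omega)
  linarith

lemma ballVol_mcd_le (hd : 1 ≤ d) {r : ℝ} (h0 : 0 ≤ r) : ballVol (mcd d) r ≤ 2 * d * r := by
  have hd' : (1 : ℝ) ≤ d := by exact_mod_cast hd
  rcases le_or_gt r (1 / 2) with hr | hr
  · rw [ballVol_mcd hd h0 hr]
    have := one_add_mul_le_pow (show (-2 : ℝ) ≤ -(2 * r) by linarith) d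
    rw [show 1 + -(2 * r) = 1 - 2 * r by ring] at this
    linarith
  · have h1 : ballVol (mcd d) r ≤ 1 := ENNReal.toReal_le_of_le_ofReal zero_le_one
      (by simpa using prob_le_one)
    nlinarith

theorem isDistanceFunction_mcd (hd : 1 ≤ d) : IsDistanceFunction (mcd d) where
  measurable := measurable_mcd
  nonneg := mcd_nonneg
  symm x := by simp [mcd]
  zero := by simp [mcd]
  surj := by
    have hcont : ContinuousOn (fun r : ℝ => 1 - (1 - 2 * r) ^ d) (Icc 0 (1 / 2)) := by fun_prop
    have := intermediate_value_Icc (show (0 : ℝ) ≤ 1 / 2 by norm_num) hcont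
    intro t ht
    obtain ⟨r, hr, hr'⟩ := this (show t ∈ _ by
      have : d ≠ 0 := by omega
      simpa [this] using ht)
    exact ⟨r, hr.1, (ballVol_mcd hd hr.1 hr.2).trans hr'⟩

/-- Take `C = 2`. Pairs of points that are both `ε`-small in component `0` have volume `(2ε) ^ 2`,
against at most `(2dε) ^ 2` for all pairs in the ball. The ratio of volumes is at least `2ε /
(4dε)`. -/
theorem stochasticTriangleInequality_mcd (hd : 1 ≤ d) :
    StochasticTriangleInequality (mcd d) := by
  have hdist := isDistanceFunction_mcd hd
  have hd' : (1 : ℝ) ≤ d := by exact_mod_cast hd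
  have hd0 : 0 < d := hd
  -- Below `1 / 4` the doubled radius stays within `1 / 2`, where the volume estimates hold.
  have hsmall : ∀ᶠ ε : ℝ in 𝓝[>] 0, ε ∈ Ioo (0 : ℝ) (1 / 4) :=
    Ioo_mem_nhdsGT (by norm_num)
  refine ⟨2, two_pos, ?_, ?_⟩
  · refine lt_of_lt_of_le (b := ENNReal.ofReal (1 / d ^ 2)) (ENNReal.ofReal_pos.2 (by positivity)) ?_
    refine le_liminf_of_le (h := ?_)
    filter_upwards [hsmall] with ε ⟨hε0, hε1⟩
    rw [volume_near_pair hdist]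
    set i : Fin d := ⟨0, hd⟩
    have hsub : {x : Torus d | ‖x i‖ ≤ ε} ×ˢ {x : Torus d | ‖x i‖ ≤ ε} ⊆
        {z : Torus d × Torus d | mcd d z.1 ≤ ε ∧ mcd d z.2 ≤ ε ∧ mcd d (z.1 - z.2) ≤ 2 * ε} := by
      rintro ⟨x, y⟩ ⟨hx, hy⟩
      simp only [mem_ofPred_eq] at hx hy ⊢
      refine ⟨(mcd_le_iff hd).2 ⟨i, hx⟩, (mcd_le_iff hd).2 ⟨i, hy⟩, (mcd_le_iff hd).2 ⟨i, ?_⟩⟩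
      rw [Pi.sub_apply]
      linarith [norm_sub_le (x i) (y i)]
    have hprod := measure_mono (μ := volume) hsub
    rw [Measure.volume_eq_prod, Measure.prod_prod, volume_component_le i (by linarith)] at hprod
    have hV0 : 0 < ballVol (mcd d) ε := by
      linarith [two_mul_le_ballVol_mcd hd hε0.le (by linarith)]
    have hVle := ballVol_mcd_le hd hε0.le
    rw [← Measure.volume_eq_prod] at hprod
    refine le_trans ?_ (mul_le_mul_right (mul_le_mul_right hprod _) _)
    rw [volume_ball, ← ENNReal.ofReal_inv_of_pos hV0, ← ENNReal.ofReal_mul (by positivity),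
      ← ENNReal.ofReal_mul (by positivity), ← ENNReal.ofReal_mul (by positivity)]
    refine ENNReal.ofReal_le_ofReal ?_
    have h1 : 1 / (d : ℝ) ≤ (ballVol (mcd d) ε)⁻¹ * (2 * ε) := by
      rw [inv_mul_eq_div, div_le_div_iff₀ (by positivity) hV0]
      linarith
    calc 1 / (d : ℝ) ^ 2 = 1 / (d : ℝ) * (1 / d) := by ring
      _ ≤ ((ballVol (mcd d) ε)⁻¹ * (2 * ε)) * ((ballVol (mcd d) ε)⁻¹ * (2 * ε)) := by gcongr
      _ = _ := by ring
  · refine lt_of_lt_of_le (b := ENNReal.ofReal (1 / (2 * d))) (ENNReal.ofReal_pos.2 (by positivity)) ?_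
    refine le_liminf_of_le (h := ?_)
    filter_upwards [hsmall] with ε ⟨hε0, hε1⟩
    have h1 := two_mul_le_ballVol_mcd hd hε0.le (by linarith)
    have h2 := two_mul_le_ballVol_mcd hd (r := 2 * ε) (by linarith) (by linarith)
    have h3 := ballVol_mcd_le hd (r := 2 * ε) (by linarith)
    rw [volume_ball, volume_ball, ← ENNReal.ofReal_div_of_pos (by linarith)]
    refine ENNReal.ofReal_le_ofReal ?_
    rw [div_le_div_iff₀ (by positivity) (by linarith)]
    nlinarith

/-- For the minimum component distance, edge probabilities formulated with `V(r) = r` and with the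
volume function are the same. -/
theorem IsEdgeProbability.ballVol_mcd {α : ℝ} (hα : 0 ≤ α) (hd : 1 ≤ d)
    {p : ℕ → Torus d → Torus d → ℝ → ℝ → ℝ}
    (hp : IsEdgeProbability α (mcd d) (fun r => r) p) :
    IsEdgeProbability α (mcd d) (ballVol (mcd d)) p where
  mem_Icc := hp.mem_Icc
  measurable := hp.measurable
  theta := by
    obtain ⟨cL, hcL, cU, hcU, hθ⟩ := hp.theta
    have hd' : (1 : ℝ) ≤ d := by exact_mod_cast hd
    -- Since `r ≤ V(r) ≤ 2 * d * r` for attained distances, passing to `V` can only lower the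
    -- kernel, by a factor of at most `(2 * d) ^ α`.
    refine ⟨cL, hcL, cU * (2 * d) ^ α, by positivity, ?_⟩
    filter_upwards [hθ, eventually_gt_atTop 0] with n hn hn0 x y hxy a ha b hb
    obtain ⟨h1, h2⟩ := hn x y hxy a ha b hb
    have hn' : (0 : ℝ) < n := by exact_mod_cast hn0
    have hab : 0 < a * b := mul_pos ha hb
    set r := mcd d (x - y) with hr
    have hr0 : 0 ≤ r := mcd_nonneg _
    have hr1 : r ≤ 1 / 2 := mcd_le_half hd _
    have hV1 := two_mul_le_ballVol_mcd hd hr0 hr1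
    have hV2 := ballVol_mcd_le hd hr0
    have hone : (1 : ℝ) ≤ (2 * d) ^ α := Real.one_le_rpow (by linarith) hα
    rcases hr0.eq_or_lt with h0 | h0
    · have hVr : ballVol (mcd d) r = 0 := by
        rw [← h0] at hV1 hV2 ⊢
        linarith
      have k1 : kernel α n (a * b) r = 1 := by rw [kernel, if_pos h0.symm]
      have k2 : kernel α n (a * b) (ballVol (mcd d) r) = 1 := by rw [kernel, if_pos hVr]
      rw [k1] at h1 h2
      rw [k2]
      refine ⟨h1, h2.trans ?_⟩
      rw [mul_one, mul_one]
      exact le_mul_of_one_le_right hcU.le hone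
    · have hV0 : 0 < ballVol (mcd d) r := by linarith
      have k1 : kernel α n (a * b) r = min 1 ((a * b / (n * r)) ^ α) := by
        rw [kernel, if_neg h0.ne']
      have k2 : kernel α n (a * b) (ballVol (mcd d) r) =
          min 1 ((a * b / (n * ballVol (mcd d) r)) ^ α) := by
        rw [kernel, if_neg hV0.ne']
      have le1 : kernel α n (a * b) (ballVol (mcd d) r) ≤ kernel α n (a * b) r := by
        rw [k1, k2]
        refine min_le_min le_rfl (Real.rpow_le_rpow (by positivity) ?_ hα)
        gcongr
        linarith
      have le2 : kernel α n (a * b) r ≤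
          (2 * d) ^ α * kernel α n (a * b) (ballVol (mcd d) r) := by
        rw [k1, k2, mul_min_of_nonneg _ _ (by positivity), mul_one,
          ← Real.mul_rpow (by positivity) (by positivity)]
        refine min_le_min hone (Real.rpow_le_rpow (by positivity) ?_ hα)
        rw [← mul_div_assoc, div_le_div_iff₀ (by positivity) (by positivity)]
        have := mul_le_mul_of_nonneg_left hV2 (mul_pos hab hn').le
        nlinarith
      refine ⟨(mul_le_mul_of_nonneg_left le1 hcL.le).trans h1, h2.trans ?_⟩
      rw [mul_assoc]
      exact mul_le_mul_of_nonneg_left le2 hcU.le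

end MinimumComponent

end GIRG

theorem mainTheorem2 (d : ℕ) (hd : 1 ≤ d) (α β : ℝ) (hα : 1 < α) (hβ : 2 < β) (hβ' : β < 3)
    (w : ∀ n : ℕ, Fin n → ℝ) (hw : GIRG.IsPowerLawWeights β w)
    (p : ℕ → GIRG.Torus d → GIRG.Torus d → ℝ → ℝ → ℝ) :
    -- every distance function with the stochastic triangle inequality
    (∀ dist : GIRG.Torus d → ℝ, GIRG.IsDistanceFunction dist →
      GIRG.StochasticTriangleInequality dist →
      GIRG.IsEdgeProbability α dist (GIRG.ballVol dist) p → GIRG.ClusteringWhp w p) ∧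
    -- the minimum component distance is such a distance function
    (GIRG.IsDistanceFunction (GIRG.mcd d) ∧ GIRG.StochasticTriangleInequality (GIRG.mcd d)) ∧
    -- hence the result holds for it, with its volume function or with `V(r) = r`
    (∀ V : ℝ → ℝ, (V = GIRG.ballVol (GIRG.mcd d) ∨ V = fun r => r) →
      GIRG.IsEdgeProbability α (GIRG.mcd d) V p → GIRG.ClusteringWhp w p) := by
  have hdist := GIRG.isDistanceFunction_mcd hd
  have htri := GIRG.stochasticTriangleInequality_mcd hd
  refine ⟨fun dist h hs hp => GIRG.clusteringWhp_ballVol hα hβ hw h hs hp, ⟨hdist, htri⟩, ?_⟩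
  rintro V (rfl | rfl) hp
  · exact GIRG.clusteringWhp_ballVol hα hβ hw hdist htri hp
  · exact GIRG.clusteringWhp_ballVol hα hβ hw hdist htri (hp.ballVol_mcd (by linarith) hd)
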